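/- Rings are associative and unital. Let $S$ be a complete, separated topological ring with a right linear topology, i.e. the open right ideals form a base of neighborhoods of zero in $S$. For a set $X$ let $S[[X]]$ be the set of all formal sums $\sum_{x\in X}a_x x$ whose coefficients $a_x\in S$ form a family converging to zero (for every open right ideal $I\subset S$ one has $a_x\in I$ for all but finitely many $x$). With the unit $x\mapsto 1\cdot x$ and the multiplication $S[[S[[X]]]]\to S[[X]]$ that opens parentheses (computing the coefficients as convergent infinite sums in $S$), the functor $X\mapsto S[[X]]$ is a monad on the category of sets. Let $S\text{-contra}$ be the (abelian) category of algebras over this monad, the left $S$-contramodules. Let $\text{discr-}S$ be the (abelian) full subcategory of the category of right $S$-modules formed by the modules in which the annihilator of every element is open in $S$. An abelian category is called split if all its short exact sequences split, semisimple if each of its objects is a coproduct of simple objects, and Ab5 if it is cocomplete and its filtered colimits are exact. For a left module $M$ over a ring $A$, the ring $\operatorname{End}_A(M)^{\mathrm{op}}$ (so that it acts on $M$ on the right) carries the finite topology, in which the annihilators of finitely generated submodules of $M$ form a base of neighborhoods of zero. For a nonempty set $Y$ and a division ring $D$, let $\operatorname{Mat}_Y(D)$ be the ring of row-finite $Y\times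 Y$ matrices over $D$, with the topology in which the sets of matrices whose rows indexed by a given finite subset of $Y$ vanish form a base of neighborhoods of zero. **Theorem.** The following conditions are equivalent: 1. the category $S\text{-contra}$ is Ab5 and semisimple; 2. the category $\text{discr-}S$ is split; 3. the category $\text{discr-}S$ is semisimple; 4. there are a ring $A$ and a semisimple left $A$-module $M$ such that $S$ is isomorphic, as a topological ring, to $\operatorname{End}_A(M)^{\mathrm{op}}$ with the finite topology; 5. there are a set $X$, a family of nonempty sets $(Y_x)_{x\in X}$ and a family of division rings $(D_x)_{x\in X}$ such that $S$ is isomorphic, as a topological ring, to $\prod_{x\in X}\operatorname{End}_{D_x}\bigl(D_x^{(Y_x)}\bigr)^{\mathrm{op}}$ with the product of the finite topologies; 6. there are a set $X$, a family of nonempty sets $(Y_x)_{x\in X}$ and a family of division rings $(D_x)_{x\in X}$ such that $S$ is isomorphic, as a topological ring, to $\prod_{x\in X}\operatorname{Mat}_{Y_x}(D_x)$ with the product topology. Topological rings satisfying these conditions are called topologically semisimple. -/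

import Mathlib

open CategoryTheory CategoryTheory.Limits Filter Topology

universe u

set_option linter.unusedSectionVars false

namespace TopSemisimple

noncomputable section

/-! ### Split, semisimple and Ab5 categories -/

/-- Every short exact sequence splits. -/
def IsSplitCategory (C : Type*) [Category* C] [Preadditive C] : Prop :=
  ∀ T : ShortComplex C, T.ShortExact → Nonempty T.Splitting

/-- Every object is a coproduct of a (small) family of simple objects. -/
def IsSemisimpleCategory (C : Type*) [Category.{u} C] [HasZeroMorphisms C] : Prop :=
  ∀ X : C, ∃ (J : Type u) (T : J → C) (i : ∀ j, T j ⟶ X),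
    (∀ j, Simple (T j)) ∧ Nonempty (IsColimit (Cofan.mk X i))

/-- Cocomplete, with exact filtered colimits. -/
def IsAb5Category (C : Type*) [Category.{u} C] : Prop :=
  ∃ _ : HasColimits C, AB5 C

/-! ### Discrete right modules -/

/-- A right `S`-module (a module over `Sᵐᵒᵖ`) is discrete if the annihilator of each of its
elements is open in `S`. -/
def isDiscreteModule (S : Type u) [Ring S] [TopologicalSpace S] :
    ObjectProperty (ModuleCat.{u} Sᵐᵒᵖ) :=
  fun N => ∀ n : N, IsOpen {s : S | MulOpposite.op s • n = 0}

/-- The category of discrete right `S`-modules, a full subcategory of right `S`-modules. -/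
abbrev Discr (S : Type u) [Ring S] [TopologicalSpace S] :=
  (isDiscreteModule S).FullSubcategory

/-! ### Left contramodules -/

/-- The set `S[[X]]` of infinite formal linear combinations `∑ aₓ x` of elements of `X` with
coefficients in `S` forming a family that converges to zero. -/
@[ext]
structure FormalSum (S : Type u) [Ring S] [TopologicalSpace S] (X : Type u) where
  coeff : X → S
  tendsto_zero : Tendsto coeff cofinite (𝓝 0)

namespace FormalSum

section

variable {S : Type u} [Ring S] [TopologicalSpace S] {X : Type u}

instance : Zero (FormalSum S X) := ⟨⟨fun _ => 0, tendsto_const_nhds⟩⟩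

@[simp] lemma zero_coeff (x : X) : (0 : FormalSum S X).coeff x = 0 := rfl

open Classical in
/-- The "point measure" `1 · x`. -/
def point (S : Type u) [Ring S] [TopologicalSpace S] {X : Type u} (x : X) : FormalSum S X where
  coeff := Pi.single x 1
  tendsto_zero := by
    refine tendsto_const_nhds.congr' ?_
    have : ({x}ᶜ : Set X) ∈ cofinite := (Set.finite_singleton x).compl_mem_cofinite
    filter_upwards [this] with y hy
    exact (Pi.single_eq_of_ne (M := fun _ : X => S) hy 1).symm

open Classical in
lemma point_coeff (x y : X) : (point S x).coeff y = if y = x then 1 else 0 := by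
  simp [point, Pi.single_apply]

end

variable {S : Type u} [Ring S] [UniformSpace S] [IsUniformAddGroup S] [IsTopologicalRing S]
  [IsLinearTopology Sᵐᵒᵖ S]

lemma nonarchimedean : NonarchimedeanAddGroup S where
  is_nonarchimedean U hU := by
    obtain ⟨I, hI, hIU⟩ := (IsLinearTopology.hasBasis_open_submodule Sᵐᵒᵖ).mem_iff.1 hU
    exact ⟨⟨I.toAddSubgroup, hI⟩, hIU⟩

lemma tendsto_zero_iff {ι : Type*} (f : ι → S) : Tendsto f cofinite (𝓝 0) ↔
    ∀ I : Submodule Sᵐᵒᵖ S, IsOpen (I : Set S) → {i | f i ∉ I}.Finite := by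
  rw [(IsLinearTopology.hasBasis_open_submodule Sᵐᵒᵖ).tendsto_right_iff]
  rfl

lemma mul_mem_right (I : Submodule Sᵐᵒᵖ S) {a : S} (ha : a ∈ I) (b : S) : a * b ∈ I :=
  I.smul_mem (MulOpposite.op b) ha

lemma tsum_mem_open {ι : Type*} (I : Submodule Sᵐᵒᵖ S) (hI : IsOpen (I : Set S)) {f : ι → S}
    (hf : ∀ i, f i ∈ I) : ∑' i, f i ∈ I :=
  tsum_mem (s := I.toAddSubgroup) (I.toAddSubgroup.isClosed_of_isOpen hI) hf

/-- Zero-convergent families of zero-convergent families. -/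
lemma tendsto_zero_prod {X Y : Type*} {a : X → S} {k : X → Y → S}
    (ha : Tendsto a cofinite (𝓝 0)) (hk : ∀ x, Tendsto (k x) cofinite (𝓝 0)) :
    Tendsto (fun p : X × Y => a p.1 * k p.1 p.2) cofinite (𝓝 0) := by
  rw [tendsto_zero_iff]
  intro I hI
  have h1 := (tendsto_zero_iff a).1 ha I hI
  have h2 : ∀ x, {y | a x * k x y ∉ I}.Finite := fun x => by
    refine (tendsto_zero_iff (fun y => a x * k x y)).1 ?_ I hI
    simpa using (hk x).const_mul (a x)
  refine (h1.biUnion (fun x _ => (h2 x).image (fun y => (x, y)))).subset ?_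
  rintro ⟨x, y⟩ hxy
  simp only [Set.mem_ofPred_eq] at hxy
  simp only [Set.mem_iUnion, Set.mem_ofPred_eq, Set.mem_image]
  exact ⟨x, fun h => hxy (mul_mem_right I h _), y, hxy, rfl⟩

/-- Substitution of the formal sums `k x` into the formal sum `a = ∑ aₓ x`: the coefficient of
the result at `y` is the convergent sum `∑ₓ aₓ (k x)_y`. -/
def bind {X Y : Type u} (a : FormalSum S X) (k : X → FormalSum S Y) : FormalSum S Y where
  coeff y := ∑' x, a.coeff x * (k x).coeff y
  tendsto_zero := by
    rw [tendsto_zero_iff]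
    intro I hI
    have h := (tendsto_zero_iff _).1
      (tendsto_zero_prod a.tendsto_zero (fun x => (k x).tendsto_zero)) I hI
    refine (h.image Prod.snd).subset fun y hy => ?_
    by_contra hcon
    refine hy (tsum_mem_open I hI fun x => ?_)
    by_contra hx
    exact hcon ⟨(x, y), hx, rfl⟩

/-- The map `S[[X]] → S[[Y]]` induced by `f : X → Y`: `∑ aₓ x ↦ ∑ aₓ f(x)`. -/
def map {X Y : Type u} (f : X → Y) (a : FormalSum S X) : FormalSum S Y :=
  a.bind fun x => point S (f x)

/-- The "opening of parentheses" map `S[[S[[X]]]] → S[[X]]`. -/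
def join {X : Type u} (t : FormalSum S (FormalSum S X)) : FormalSum S X :=
  t.bind id

lemma map_coeff {X Y : Type u} (f : X → Y) (a : FormalSum S X) (y : Y) :
    (a.map f).coeff y = ∑' x : {x // f x = y}, a.coeff x := by
  classical
  change ∑' x, a.coeff x * (point S (f x)).coeff y = ∑' x : ({x | f x = y} : Set X), a.coeff x
  rw [tsum_subtype]
  refine tsum_congr fun x => ?_
  by_cases h : f x = y
  · simp [point_coeff, h, Set.indicator]
  · simp [point_coeff, h, Ne.symm h, Set.indicator]

lemma join_coeff {X : Type u} (t : FormalSum S (FormalSum S X)) (x : X) :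
    t.join.coeff x = ∑' a : FormalSum S X, t.coeff a * a.coeff x := rfl

lemma point_bind {X Y : Type u} (x : X) (k : X → FormalSum S Y) : (point S x).bind k = k x := by
  classical
  ext y
  change ∑' x', (point S x).coeff x' * (k x').coeff y = _
  rw [tsum_eq_single x]
  · simp [point_coeff]
  · intro x' hx'
    simp [point_coeff, hx']

lemma bind_point [T2Space S] {X : Type u} (a : FormalSum S X) : a.bind (point S) = a := by
  classical
  ext y
  change ∑' x, a.coeff x * (point S x).coeff y = _
  rw [tsum_eq_single y]
  · simp [point_coeff]
  · intro x' hx'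
    simp [point_coeff, hx'.symm]

lemma bind_zero {X Y : Type u} (a : FormalSum S X) :
    a.bind (fun _ => (0 : FormalSum S Y)) = 0 := by
  ext y
  change ∑' x, a.coeff x * 0 = 0
  simp

variable [CompleteSpace S] [T2Space S]

lemma summable_of_tendsto {ι : Type*} {f : ι → S} (hf : Tendsto f cofinite (𝓝 0)) :
    Summable f :=
  have := nonarchimedean (S := S)
  NonarchimedeanAddGroup.summable_of_tendsto_cofinite_zero hf

lemma bind_assoc {X Y Z : Type u} (a : FormalSum S X) (k : X → FormalSum S Y)
    (l : Y → FormalSum S Z) : (a.bind k).bind l = a.bind fun x => (k x).bind l := by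
  ext z
  change ∑' y, (∑' x, a.coeff x * (k x).coeff y) * (l y).coeff z =
    ∑' x, a.coeff x * ∑' y, (k x).coeff y * (l y).coeff z
  have hprod := tendsto_zero_prod a.tendsto_zero (fun x => (k x).tendsto_zero)
  have hkl : ∀ x, Tendsto (fun y => (k x).coeff y * (l y).coeff z) cofinite (𝓝 0) := fun x =>
    IsLinearTopology.tendsto_smul_zero Sᵐᵒᵖ (fun y => MulOpposite.op ((l y).coeff z)) _
      (k x).tendsto_zero
  have hmain := summable_of_tendsto (tendsto_zero_prod a.tendsto_zero hkl)
  have hy : ∀ y, Summable fun x => a.coeff x * (k x).coeff y := fun y =>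
    summable_of_tendsto (hprod.comp
      (Function.Injective.tendsto_cofinite (f := fun x : X => (x, y))
        fun _ _ h => (Prod.ext_iff.1 h).1))
  calc ∑' y, (∑' x, a.coeff x * (k x).coeff y) * (l y).coeff z
      = ∑' y, ∑' x, a.coeff x * ((k x).coeff y * (l y).coeff z) := by
        refine tsum_congr fun y => ?_
        rw [← (hy y).tsum_mul_right]
        exact tsum_congr fun x => mul_assoc _ _ _
    _ = ∑' x, ∑' y, a.coeff x * ((k x).coeff y * (l y).coeff z) :=
        Summable.tsum_comm (f := fun x y => a.coeff x * ((k x).coeff y * (l y).coeff z)) hmain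
    _ = _ := tsum_congr fun x => (summable_of_tendsto (hkl x)).tsum_mul_left _

end FormalSum

section Contra

variable (S : Type u) [Ring S] [UniformSpace S] [IsUniformAddGroup S] [IsTopologicalRing S]
  [IsLinearTopology Sᵐᵒᵖ S] [CompleteSpace S] [T2Space S]

/-- The monad `X ↦ S[[X]]` on the category of sets. -/
def contraMonad : CategoryTheory.Monad (Type u) where
  obj X := FormalSum S X
  map f := ↾(FormalSum.map f)
  map_id X := by
    refine ConcreteCategory.hom_ext _ _ fun a => ?_
    exact FormalSum.bind_point a
  map_comp f g := by
    refine ConcreteCategory.hom_ext _ _ fun a => ?_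
    change FormalSum.map _ a = FormalSum.map _ (FormalSum.map _ a)
    simp only [FormalSum.map, FormalSum.bind_assoc, FormalSum.point_bind]
    rfl
  η :=
    { app := fun X => ↾(FormalSum.point S)
      naturality := fun X Y f => by
        refine ConcreteCategory.hom_ext _ _ fun x => ?_
        exact (FormalSum.point_bind x _).symm }
  μ :=
    { app := fun X => ↾FormalSum.join
      naturality := fun X Y f => by
        refine ConcreteCategory.hom_ext _ _ fun t => ?_
        change FormalSum.join (FormalSum.map (FormalSum.map f) t) =
          FormalSum.map f (FormalSum.join t)
        simp only [FormalSum.map, FormalSum.join, FormalSum.bind_assoc, FormalSum.point_bind]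
        rfl }
  assoc X := by
    refine ConcreteCategory.hom_ext _ _ fun t => ?_
    change FormalSum.join (FormalSum.map FormalSum.join t) = FormalSum.join (FormalSum.join t)
    simp only [FormalSum.map, FormalSum.join, FormalSum.bind_assoc, FormalSum.point_bind]
    rfl
  left_unit X := by
    refine ConcreteCategory.hom_ext _ _ fun a => ?_
    exact FormalSum.point_bind a _
  right_unit X := by
    refine ConcreteCategory.hom_ext _ _ fun a => ?_
    change FormalSum.join (FormalSum.map (FormalSum.point S) a) = a
    simp only [FormalSum.map, FormalSum.join, FormalSum.bind_assoc, FormalSum.point_bind]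
    exact FormalSum.bind_point a

/-- The category of left `S`-contramodules: algebras (modules) over the monad `X ↦ S[[X]]`. -/
abbrev Contra := (contraMonad S).Algebra

variable {S}

/-- The contraaction map `S[[C]] → C`. -/
def contraaction (C : Contra S) : FormalSum S C.A → C.A := C.a

/-- The zero element of a contramodule. -/
def contraZero (C : Contra S) : C.A := contraaction C 0

lemma contraaction_join (C : Contra S) (t : FormalSum S (FormalSum S C.A)) :
    contraaction C t.join = contraaction C (t.map (contraaction C)) :=
  ConcreteCategory.congr_hom C.assoc t

lemma hom_contraaction {B C : Contra S} (f : B ⟶ C) (t : FormalSum S B.A) :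
    contraaction C (t.map f.f) = f.f (contraaction B t) :=
  ConcreteCategory.congr_hom f.h t

lemma contraaction_map_zero (C : Contra S) {X : Type u} (t : FormalSum S X) :
    contraaction C (t.map fun _ => contraZero C) = contraZero C := by
  have h := contraaction_join C (t.map fun _ => (0 : FormalSum S C.A))
  simp only [FormalSum.map, FormalSum.join, FormalSum.bind_assoc, FormalSum.point_bind, id,
    FormalSum.bind_zero] at h
  exact h.symm

lemma hom_contraZero {B C : Contra S} (f : B ⟶ C) : f.f (contraZero B) = contraZero C := by
  have h := hom_contraaction f 0
  have h0 : (0 : FormalSum S B.A).map f.f = 0 := by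
    ext y
    change ∑' x, 0 * _ = 0
    simp
  rw [h0] at h
  exact h.symm

instance : HasZeroMorphisms (Contra S) where
  zero B C := ⟨
    { f := ↾(fun _ => contraZero C)
      h := by
        refine ConcreteCategory.hom_ext _ _ fun t => ?_
        exact contraaction_map_zero C t }⟩
  comp_zero {_ _} _ _ := rfl
  zero_comp B {C D} f := by
    apply Monad.Algebra.Hom.ext
    refine ConcreteCategory.hom_ext _ _ fun x => ?_
    exact hom_contraZero f

end Contra

/-! ### Topological rings of endomorphisms and of row-finite matrices -/

/-- `R` and `T` are isomorphic as topological rings. -/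
def IsTopRingIso (R T : Type*) [Ring R] [TopologicalSpace R] [Ring T] [TopologicalSpace T] :
    Prop :=
  ∃ e : R ≃+* T, Continuous e ∧ Continuous e.symm

/-- The endomorphism ring `Hom_A(M, M)ᵒᵖ` of a left `A`-module `M`, acting in `M` on the right. -/
def EndOp (A M : Type*) [Ring A] [AddCommGroup M] [Module A M] := (Module.End A M)ᵐᵒᵖ

section EndOp

variable (A M : Type*) [Ring A] [AddCommGroup M] [Module A M]

instance : Ring (EndOp A M) := inferInstanceAs (Ring (Module.End A M)ᵐᵒᵖ)

variable {A M} in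
/-- The underlying map of an element of the endomorphism ring. -/
def EndOp.apply (f : EndOp A M) : M → M := (MulOpposite.unop f : Module.End A M)

/-- The finite topology: the topology of pointwise convergence for the discrete topology on `M`.
See `EndOp.hasBasis_nhds_zero`. -/
instance : TopologicalSpace (EndOp A M) :=
  TopologicalSpace.induced EndOp.apply
    (@Pi.topologicalSpace M (fun _ => M) (fun _ => ⊥))

/-- A base of neighborhoods of zero is given by the annihilators of finitely generated
submodules. -/
lemma EndOp.hasBasis_nhds_zero :
    (𝓝 (0 : EndOp A M)).HasBasis (fun E : Submodule A M => E.FG)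
      (fun E => {f | ∀ m ∈ E, f.apply m = 0}) := by
  let _ : TopologicalSpace M := ⊥
  have : DiscreteTopology M := ⟨rfl⟩
  have h0 : 𝓝 (0 : EndOp A M) = comap EndOp.apply (Filter.pi fun _ : M => pure (0 : M)) := by
    have h := nhds_induced (EndOp.apply (A := A) (M := M)) 0
    have h1 : (0 : EndOp A M).apply = fun _ => 0 := rfl
    rw [h1, nhds_pi] at h
    simpa only [nhds_discrete] using h
  rw [h0]
  refine ⟨fun U => ?_⟩
  rw [mem_comap]
  constructor
  · rintro ⟨V, hV, hVU⟩
    rw [Filter.mem_pi] at hV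
    obtain ⟨I, hI, t, ht, hsub⟩ := hV
    refine ⟨Submodule.span A I, ⟨hI.toFinset, by simp⟩, fun f hf => hVU (hsub fun m hm => ?_)⟩
    change f.apply m ∈ t m
    rw [hf m (Submodule.subset_span hm)]
    exact mem_pure.1 (ht m)
  · rintro ⟨E, ⟨s, rfl⟩, hEU⟩
    refine ⟨(s : Set M).pi fun _ => {0},
      Filter.pi_mem_pi s.finite_toSet fun _ _ => mem_pure.2 rfl, fun f hf => hEU ?_⟩
    intro m hm
    have : Submodule.span A (s : Set M) ≤
        LinearMap.ker (MulOpposite.unop (α := Module.End A M) f) :=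
      Submodule.span_le.2 fun x hx => hf x hx
    exact this hm

end EndOp

/-- The `Y × Y` matrices over `D` with finitely many nonzero entries in each row. -/
def RowFiniteMatrix (Y D : Type*) [Ring D] := Y → Y →₀ D

namespace RowFiniteMatrix

variable (Y D : Type*) [Ring D]

instance : AddCommGroup (RowFiniteMatrix Y D) := inferInstanceAs (AddCommGroup (Y → Y →₀ D))

/-- `(a b)_{x,z} = ∑_y a_{x,y} b_{y,z}`. -/
instance : Mul (RowFiniteMatrix Y D) := ⟨fun a b x => (a x).sum fun y d => d • b y⟩

open Classical in
instance : One (RowFiniteMatrix Y D) := ⟨fun x => Finsupp.single x 1⟩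

variable {Y D}

/-- The row of a matrix with a given index. -/
def row (a : RowFiniteMatrix Y D) : Y → Y →₀ D := a

@[ext]
lemma ext {a b : RowFiniteMatrix Y D} (h : ∀ x, a.row x = b.row x) : a = b := funext h

lemma row_mul (a b : RowFiniteMatrix Y D) (x : Y) :
    (a * b).row x = Finsupp.linearCombination D b.row (a.row x) := rfl

lemma entry_mul (a b : RowFiniteMatrix Y D) (x z : Y) :
    (a * b).row x z = ∑ y ∈ (a.row x).support, a.row x y * b.row y z := by
  simp [row_mul, Finsupp.linearCombination_apply, Finsupp.sum, Finsupp.finsetSum_apply]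

lemma row_one (x : Y) : (1 : RowFiniteMatrix Y D).row x = Finsupp.single x 1 := rfl

lemma row_add (a b : RowFiniteMatrix Y D) : (a + b).row = a.row + b.row := rfl

lemma row_zero : (0 : RowFiniteMatrix Y D).row = 0 := rfl

instance : Ring (RowFiniteMatrix Y D) where
  __ := (inferInstance : AddCommGroup (RowFiniteMatrix Y D))
  mul := (· * ·)
  one := 1
  mul_assoc a b c := by
    ext1 x
    rw [row_mul, row_mul, row_mul]
    induction a.row x using Finsupp.induction_linear with
    | zero => simp
    | add f g hf hg => simp only [map_add, hf, hg]
    | single y d => simp [Finsupp.linearCombination_single, row_mul]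
  one_mul a := by
    ext1 x
    simp [row_mul, row_one, Finsupp.linearCombination_single]
  mul_one a := by
    ext1 x
    rw [row_mul, Finsupp.linearCombination_apply]
    simp [row_one]
  zero_mul a := by
    ext1 x
    simp [row_mul, row_zero]
  mul_zero a := by
    ext1 x
    simp [row_mul, row_zero]
  left_distrib a b c := by
    ext1 x
    simp [row_mul, row_add, Finsupp.linearCombination_apply]
  right_distrib a b c := by
    ext1 x
    simp [row_mul, row_add]
  zsmul := fun n a => n • a
  nsmul := fun n a => n • a

/-- For the discrete topology on `D`: a base of neighborhoods of zero is formed by the sets of all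
matrices whose rows indexed by a given finite subset of `Y` vanish. -/
instance : TopologicalSpace (RowFiniteMatrix Y D) :=
  @Pi.topologicalSpace Y (fun _ => Y →₀ D) (fun _ => ⊥)

end RowFiniteMatrix

end

end TopSemisimple

/-! The pivot is `IsSimpleDecomposition`: nonzero orthogonal idempotents `e i` with convergent sum
`1`, each generating a simple right ideal. Conditions on contramodules, on discrete modules and on
endomorphism rings are all compared through such a family.

Discrete modules: a vector `n` has an open annihilator, so convergence of the partial sums to `1`
makes it a finite sum of vectors `n e i`, each of which is zero or generates a simple submodule.
Hence a decomposition makes all discrete modules semisimple. Being split and being semisimple both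
amount to this for `Discr S`, since that category is closed under submodules, quotients and
colimits. Conversely, if all discrete modules are semisimple, then every `S ⧸ I` with `I` open
embeds its generator into a finite sum of simple modules, so annihilators of finite sets of vectors
of simple modules define the topology. Jacobson density together with completeness then identifies
`S` with the bicommutant of the direct sum of one copy of each simple discrete module. By Schur's
lemma this bicommutant is a product of endomorphism rings of vector spaces; bases turn these into
row-finite matrices. In the other direction, the projections of a semisimple module onto its simple
summands form a decomposition.

Contramodules: the free contramodule with one generator has `S` as its endomorphism ring, so
splitting it into simple objects yields a decomposition (`isSimpleDecomposition_endElt`).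
Conversely, given a decomposition, each `e i S` is discrete (`isOpen_mul_eq_zero`). Therefore any
fixed component `e i c` of an infinite linear combination is a finite sum, and a contramodule is
governed by its elements with finitely many nonzero components. This gives an equivalence
`finitePartFunctor` with the locally unital modules over the ring generated by the corners `e i S e
j`. Such modules form an Ab5 category, and they are semisimple because nonzero elements of corners
are invertible (`exists_mul_left`). -/

namespace TopSemisimple

noncomputable section

/-! ### Full subcategories of modules given by filters of ideals -/

section TorsionClass

variable {R : Type u} [Ring R]

/-- The modules in which the annihilators of all elements belong to a given filter of left
ideals. -/
def torsionClass (F : Order.PFilter (Ideal R)) : ObjectProperty (ModuleCat.{u} R) :=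
  fun N => ∀ n : N, LinearMap.ker (LinearMap.toSpanSingleton R N n) ∈ F

variable (F : Order.PFilter (Ideal R))

instance : (torsionClass F).IsClosedUnderSubobjects where
  prop_of_mono {X Y} f _ hY x := by
    have hf := (ModuleCat.mono_iff_injective f).1 inferInstance
    refine F.mem_of_le (fun r hr => ?_) (hY (f x))
    simp only [LinearMap.mem_ker, LinearMap.toSpanSingleton_apply] at hr ⊢
    apply hf
    simpa using hr

instance : (torsionClass F).IsClosedUnderQuotients where
  prop_of_epi {X Y} f _ hX y := by
    obtain ⟨x, rfl⟩ := (ModuleCat.epi_iff_surjective f).1 inferInstance y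
    refine F.mem_of_le (fun r hr => ?_) (hX x)
    simp only [LinearMap.mem_ker, LinearMap.toSpanSingleton_apply] at hr ⊢
    rw [← map_smul, hr, map_zero]

lemma torsionClass_zero_mem {N : Type u} [AddCommGroup N] [Module R N] :
    LinearMap.ker (LinearMap.toSpanSingleton R N 0) ∈ F :=
  F.mem_of_le (fun r _ => by simp) F.top_mem

lemma torsionClass_add_mem {N : Type u} [AddCommGroup N] [Module R N] {x y : N}
    (hx : LinearMap.ker (LinearMap.toSpanSingleton R N x) ∈ F)
    (hy : LinearMap.ker (LinearMap.toSpanSingleton R N y) ∈ F) :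
    LinearMap.ker (LinearMap.toSpanSingleton R N (x + y)) ∈ F := by
  refine F.mem_of_le ?_ (F.inf_mem hx hy)
  rintro r ⟨h1, h2⟩
  simp_all

instance : (torsionClass F).ContainsZero where
  exists_zero := ⟨ModuleCat.of R PUnit, ModuleCat.isZero_of_subsingleton _, fun n => by
    cases n; exact torsionClass_zero_mem F⟩


instance : (torsionClass F).IsClosedUnderFiniteProducts where
  isClosedUnderLimitsOfShape J _ := ⟨by
    rintro X ⟨h⟩ n
    cases nonempty_fintype J
    have key : ∀ s : Finset J, s.inf (fun j => LinearMap.ker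
        (LinearMap.toSpanSingleton R _ (h.π.app ⟨j⟩ n))) ∈ F := fun s => by
      classical
      induction s using Finset.induction_on with
      | empty => exact F.top_mem
      | insert j s _ ih =>
        rw [Finset.inf_insert]
        exact F.inf_mem (h.prop_diag_obj ⟨j⟩ _) ih
    refine F.mem_of_le (fun r hr => ?_) (key Finset.univ)
    simp only [LinearMap.mem_ker, LinearMap.toSpanSingleton_apply]
    refine Concrete.isLimit_ext _ h.isLimit _ _ fun ⟨j⟩ => ?_
    have := Finset.inf_le (f := fun j => LinearMap.ker
        (LinearMap.toSpanSingleton R _ (h.π.app ⟨j⟩ n))) (Finset.mem_univ j) hr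
    simp only [LinearMap.mem_ker, LinearMap.toSpanSingleton_apply] at this
    change h.π.app ⟨j⟩ (r • n) = h.π.app ⟨j⟩ 0
    rw [map_smul, this, map_zero]⟩

/-- The quotient map by the sum of the images vanishes on every leg of the colimit cocone, hence is
zero. -/
lemma iSup_range_eq_top_of_isColimit {J : Type*} [Category* J] {G : J ⥤ ModuleCat.{u} R}
    {c : Cocone G} (hc : IsColimit c) :
    ⨆ j, LinearMap.range (ModuleCat.Hom.hom (B := c.pt) (c.ι.app j)) = ⊤ := by
  set K := ⨆ j, LinearMap.range (ModuleCat.Hom.hom (B := c.pt) (c.ι.app j)) with hK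
  have h : ModuleCat.ofHom K.mkQ = 0 := hc.hom_ext fun j => by
    ext x
    exact (Submodule.Quotient.mk_eq_zero K).2 (le_iSup
      (fun j => LinearMap.range (ModuleCat.Hom.hom (B := c.pt) (c.ι.app j))) j
      ⟨x, rfl⟩)
  rw [← Submodule.ker_mkQ K, LinearMap.ker_eq_top]
  simpa using congrArg ModuleCat.Hom.hom h

instance (J : Type*) [Category* J] : (torsionClass F).IsClosedUnderColimitsOfShape J :=
  ⟨by
    rintro X ⟨h⟩ n
    have hn : n ∈ ⨆ j, LinearMap.range (ModuleCat.Hom.hom (B := X) (h.ι.app j)) := by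
      rw [iSup_range_eq_top_of_isColimit h.isColimit]; trivial
    refine Submodule.iSup_induction _
      (motive := fun n => LinearMap.ker (LinearMap.toSpanSingleton R X n) ∈ F) hn ?_
      (torsionClass_zero_mem F) (fun x y hx hy => torsionClass_add_mem F hx hy)
    rintro j _ ⟨x, rfl⟩
    refine F.mem_of_le (fun r hr => ?_) (h.prop_diag_obj j x)
    simp only [LinearMap.mem_ker, LinearMap.toSpanSingleton_apply] at hr ⊢
    rw [← map_smul, hr, map_zero]⟩

/-- The inclusion into all modules creates no new colimits or finite limits, so exactness of
filtered colimits is inherited from modules. -/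
lemma isAb5Category_torsionClass : IsAb5Category (torsionClass F).FullSubcategory := by
  have hc : HasColimits (torsionClass F).FullSubcategory := ⟨fun _ _ => inferInstance⟩
  have := (torsionClass F).preservesKernels_ι
  have : PreservesFiniteLimits (torsionClass F).ι :=
    (torsionClass F).ι.preservesFiniteLimits_of_preservesKernels
  refine ⟨hc, ⟨fun J _ _ => ?_⟩⟩
  exact HasExactColimitsOfShape.domain_of_functor J (torsionClass F).ι

variable {F}

lemma torsionClass_mono_iff {X Y : (torsionClass F).FullSubcategory} (f : X ⟶ Y) :
    Mono f ↔ Function.Injective f.hom := by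
  have := (torsionClass F).preservesMonomorphisms_ι_of_isNormalEpiCategory
  rw [← ModuleCat.mono_iff_injective]
  exact ((torsionClass F).ι.mono_map_iff_mono f).symm

lemma torsionClass_epi_iff {X Y : (torsionClass F).FullSubcategory} (f : X ⟶ Y) :
    Epi f ↔ Function.Surjective f.hom := by
  have := (torsionClass F).preservesEpimorphisms_ι_of_isNormalMonoCategory
  rw [← ModuleCat.epi_iff_surjective]
  exact ((torsionClass F).ι.epi_map_iff_epi f).symm

lemma torsionClass_of_injective {M N : Type u} [AddCommGroup M] [Module R M] [AddCommGroup N]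
    [Module R N] (f : M →ₗ[R] N) (hf : Function.Injective f)
    (hN : torsionClass F (ModuleCat.of R N)) : torsionClass F (ModuleCat.of R M) :=
  have : Mono (ModuleCat.ofHom f) := (ModuleCat.mono_iff_injective _).2 hf
  (torsionClass F).prop_of_mono (ModuleCat.ofHom f) hN

lemma torsionClass_of_surjective {M N : Type u} [AddCommGroup M] [Module R M] [AddCommGroup N]
    [Module R N] (f : M →ₗ[R] N) (hf : Function.Surjective f)
    (hM : torsionClass F (ModuleCat.of R M)) : torsionClass F (ModuleCat.of R N) :=
  have : Epi (ModuleCat.ofHom f) := (ModuleCat.epi_iff_surjective _).2 hf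
  (torsionClass F).prop_of_epi (ModuleCat.ofHom f) hM

lemma torsionClass_simple_iff (X : (torsionClass F).FullSubcategory) :
    Simple X ↔ IsSimpleModule R X.obj := by
  rw [← simple_iff_isSimpleModule']
  constructor
  · intro hX
    refine ⟨fun {Y} f hf => ?_⟩
    let Y' : (torsionClass F).FullSubcategory := ⟨Y, (torsionClass F).prop_of_mono f X.property⟩
    let f' : Y' ⟶ X := ObjectProperty.homMk f
    have hm : Mono f' := (torsionClass_mono_iff f').2 ((ModuleCat.mono_iff_injective f).1 hf)
    have := Simple.mono_isIso_iff_nonzero f'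
    rw [← ObjectProperty.isIso_hom_iff] at this
    rw [show IsIso f ↔ f' ≠ 0 from this, not_iff_not]
    exact ⟨fun h => congrArg (fun g => g.hom) h, fun h => ObjectProperty.hom_ext _ h⟩
  · intro hX
    have := (torsionClass F).preservesMonomorphisms_ι_of_isNormalEpiCategory
    have : Simple ((torsionClass F).ι.obj X) := hX
    exact (torsionClass F).ι.simple_of_simple_obj X

/-- Coproducts inside the class are direct sums. In one direction the images of the simple summands
span; in the other the simple submodules lie in the class, and their direct sum decomposition is a
coproduct there. -/
lemma torsionClass_isSemisimpleCategory_iff :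
    IsSemisimpleCategory (torsionClass F).FullSubcategory ↔
      ∀ X : (torsionClass F).FullSubcategory, IsSemisimpleModule R X.obj := by
  constructor
  · intro h X
    obtain ⟨J, T, i, hT, ⟨hc⟩⟩ := h X
    set K := ⨆ j, LinearMap.range (i j).hom.hom with hK
    have hK' : K = ⊤ := by
      let Q : (torsionClass F).FullSubcategory := ⟨ModuleCat.of R (X.obj ⧸ K),
        torsionClass_of_surjective K.mkQ K.mkQ_surjective X.property⟩
      let q : X ⟶ Q := ObjectProperty.homMk (ModuleCat.ofHom K.mkQ)
      have h : q = 0 := hc.hom_ext fun ⟨j⟩ => by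
        ext x
        exact (Submodule.Quotient.mk_eq_zero K).2
          (le_iSup (fun j => LinearMap.range (i j).hom.hom) j ⟨x, rfl⟩)
      rw [← Submodule.ker_mkQ K, LinearMap.ker_eq_top]
      exact congrArg (fun g => g.hom.hom) h
    refine isSemisimpleModule_of_isSemisimpleModule_submodule' (fun j => ?_) hK'
    have := (torsionClass_simple_iff _).1 (hT j)
    exact IsSemisimpleModule.range _
  · intro h X
    classical
    have := h X
    obtain ⟨s, e, -, hs⟩ := IsSemisimpleModule.exists_linearEquiv_dfinsupp R X.obj
    let T : s → (torsionClass F).FullSubcategory := fun m => ⟨ModuleCat.of R m.1,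
      torsionClass_of_injective m.1.subtype m.1.subtype_injective X.property⟩
    let i : ∀ m, T m ⟶ X := fun m => ObjectProperty.homMk
      (ModuleCat.ofHom (e.symm.toLinearMap ∘ₗ DFinsupp.lsingle (R := R) (M := fun m : s => m.1) m))
    refine ⟨s, T, i, fun m => (torsionClass_simple_iff _).2 (hs m), ⟨?_⟩⟩
    refine Cofan.IsColimit.mk _ (fun c => ObjectProperty.homMk (ModuleCat.ofHom
      (DFinsupp.lsum ℕ (fun m => (c.inj m).hom.hom) ∘ₗ e.toLinearMap))) ?_ ?_
    · intro c m
      ext x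
      simp [i]
    · intro c f hf
      ext x
      obtain ⟨y, rfl⟩ := e.symm.surjective x
      simp only [ObjectProperty.homMk_hom, ModuleCat.hom_ofHom, LinearMap.comp_apply,
        LinearEquiv.coe_coe, LinearEquiv.apply_symm_apply]
      induction y using DFinsupp.induction with
      | h0 => simp
      | ha m b y _ _ ih =>
        rw [map_add, map_add, map_add, ih]
        congr 1
        rw [DFinsupp.lsum_single]
        exact congrArg (fun g => g.hom.hom b) (hf m)

/-- A submodule and its quotient both stay in the class, so the splitting of their short exact
sequence is a complement; conversely a semisimple middle term gives a retraction of the left map. -/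
lemma torsionClass_isSplitCategory_iff :
    IsSplitCategory (torsionClass F).FullSubcategory ↔
      ∀ X : (torsionClass F).FullSubcategory, IsSemisimpleModule R X.obj := by
  constructor
  · intro h X
    refine (isSemisimpleModule_iff _ _).2 ⟨fun K => ?_⟩
    let A : (torsionClass F).FullSubcategory := ⟨ModuleCat.of R K,
      torsionClass_of_injective K.subtype K.subtype_injective X.property⟩
    let Q : (torsionClass F).FullSubcategory := ⟨ModuleCat.of R (X.obj ⧸ K),
        torsionClass_of_surjective K.mkQ K.mkQ_surjective X.property⟩
    let i : A ⟶ X := ObjectProperty.homMk (ModuleCat.ofHom K.subtype)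
    let q : X ⟶ Q := ObjectProperty.homMk (ModuleCat.ofHom K.mkQ)
    let T : ShortComplex (torsionClass F).FullSubcategory := ShortComplex.mk i q (by
      ext x
      exact (Submodule.Quotient.mk_eq_zero K).2 x.2)
    have hi : Mono i := (torsionClass_mono_iff i).2 K.subtype_injective
    have hq : Epi q := (torsionClass_epi_iff q).2 K.mkQ_surjective
    have hT : T.Exact := by
      refine T.exact_of_f_is_kernel (KernelFork.IsLimit.ofι _ _
        (fun {W} g hg => ObjectProperty.homMk (ModuleCat.ofHom (g.hom.hom.codRestrict K fun x =>
          (Submodule.Quotient.mk_eq_zero K).1 ?_))) ?_ ?_)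
      · exact congrArg (fun g => g.hom.hom x) hg
      · intro W g hg
        ext x
        rfl
      · intro W g hg m hm
        rw [← cancel_mono i, hm]
        ext x
        rfl
    obtain ⟨σ⟩ := h T ⟨hT⟩
    refine ⟨LinearMap.ker σ.r.hom.hom, ?_⟩
    refine LinearMap.isCompl_of_proj fun x => ?_
    exact congrArg (fun g => g.hom.hom x) σ.f_r
  · intro h T hT
    have := h T.X₂
    have h1 := (torsionClass_mono_iff T.f).1 hT.mono_f
    obtain ⟨r, hr⟩ := IsSemisimpleModule.extension_property T.f.hom.hom h1 LinearMap.id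
    have := hT.epi_g
    refine ⟨ShortComplex.Splitting.ofExactOfRetraction T hT.exact
      (ObjectProperty.homMk (ModuleCat.ofHom r)) ?_ inferInstance⟩
    ext x
    exact LinearMap.congr_fun hr x

end TorsionClass

/-! ### Isomorphisms of topological rings -/

lemma IsTopRingIso.trans {R T U : Type*} [Ring R] [TopologicalSpace R] [Ring T]
    [TopologicalSpace T] [Ring U] [TopologicalSpace U] (h : IsTopRingIso R T)
    (h' : IsTopRingIso T U) : IsTopRingIso R U := by
  obtain ⟨e, he, he'⟩ := h
  obtain ⟨f, hf, hf'⟩ := h'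
  exact ⟨e.trans f, hf.comp he, he'.comp hf'⟩

lemma IsTopRingIso.symm {R T : Type*} [Ring R] [TopologicalSpace R] [Ring T]
    [TopologicalSpace T] (h : IsTopRingIso R T) : IsTopRingIso T R := by
  obtain ⟨e, he, he'⟩ := h
  exact ⟨e.symm, he', he⟩

lemma IsTopRingIso.pi {X : Type*} {R T : X → Type*} [∀ x, Ring (R x)]
    [∀ x, TopologicalSpace (R x)] [∀ x, Ring (T x)] [∀ x, TopologicalSpace (T x)]
    (h : ∀ x, IsTopRingIso (R x) (T x)) : IsTopRingIso (∀ x, R x) (∀ x, T x) := by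
  choose e he he' using h
  exact ⟨RingEquiv.piCongrRight e, continuous_pi fun x => (he x).comp (continuous_apply x),
    continuous_pi fun x => (he' x).comp (continuous_apply x)⟩

/-! ### The finite topology -/

section EndOp

variable {A M : Type*} [Ring A] [AddCommGroup M] [Module A M]

lemma EndOp.continuous_iff {Z : Type*} [TopologicalSpace Z] {g : Z → EndOp A M} :
    Continuous g ↔ ∀ m, @Continuous Z M _ ⊥ fun z => (g z).apply m := by
  let _ : TopologicalSpace M := ⊥
  rw [continuous_induced_rng, continuous_pi_iff]
  rfl

lemma EndOp.continuous_apply (m : M) :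
    @Continuous (EndOp A M) M _ ⊥ fun f => f.apply m :=
  EndOp.continuous_iff.1 continuous_id m

lemma EndOp.tendsto_iff {α : Type*} {l : Filter α} {g : α → EndOp A M} {f : EndOp A M} :
    Tendsto g l (𝓝 f) ↔ ∀ m, ∀ᶠ z in l, (g z).apply m = f.apply m := by
  let _ : TopologicalSpace M := ⊥
  have : DiscreteTopology M := ⟨rfl⟩
  have h := nhds_induced (EndOp.apply (A := A) (M := M)) f
  rw [show 𝓝 f = _ from h, tendsto_comap_iff, tendsto_pi_nhds]
  simp only [nhds_discrete, tendsto_pure]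
  rfl

instance : IsTopologicalAddGroup (EndOp A M) := by
  let _ : TopologicalSpace M := ⊥
  have : DiscreteTopology M := ⟨rfl⟩
  let φ : EndOp A M →+ (M → M) :=
    { toFun := EndOp.apply
      map_zero' := rfl
      map_add' := fun _ _ => rfl }
  exact topologicalAddGroup_induced φ

lemma EndOp.apply_mul (f g : EndOp A M) (m : M) : (f * g).apply m = g.apply (f.apply m) := rfl

lemma EndOp.apply_one (m : M) : (1 : EndOp A M).apply m = m := rfl

lemma EndOp.apply_zero (m : M) : (0 : EndOp A M).apply m = 0 := rfl

lemma EndOp.apply_sum {ι : Type*} (s : Finset ι) (f : ι → EndOp A M) (m : M) :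
    (∑ i ∈ s, f i).apply m = ∑ i ∈ s, (f i).apply m := by
  let φ : EndOp A M →+ M :=
    { toFun := fun f => f.apply m
      map_zero' := rfl
      map_add' := fun _ _ => rfl }
  exact map_sum φ f s

lemma EndOp.ext {f g : EndOp A M} (h : ∀ m, f.apply m = g.apply m) : f = g :=
  MulOpposite.unop_injective (LinearMap.ext h)

/-- An endomorphism as an element of the opposite ring of endomorphisms. -/
def EndOp.of (f : Module.End A M) : EndOp A M := MulOpposite.op f

@[simp] lemma EndOp.of_apply (f : Module.End A M) (m : M) : (EndOp.of f).apply m = f m := rfl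

lemma EndOp.isTopRingIso_of_linearEquiv {N : Type*} [AddCommGroup N] [Module A N]
    (e : M ≃ₗ[A] N) : IsTopRingIso (EndOp A M) (EndOp A N) := by
  let _ : TopologicalSpace M := ⊥
  let _ : TopologicalSpace N := ⊥
  refine ⟨RingEquiv.op e.conjRingEquiv, ?_, ?_⟩
  · refine EndOp.continuous_iff.2 fun n => ?_
    exact continuous_bot.comp (EndOp.continuous_apply (e.symm n))
  · refine EndOp.continuous_iff.2 fun n => ?_
    exact continuous_bot.comp (EndOp.continuous_apply (e n))

/-- Endomorphisms of a free module with a fixed basis are row-finite matrices. -/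
lemma EndOp.isTopRingIso_rowFiniteMatrix (Y D : Type*) [Ring D] :
    IsTopRingIso (EndOp D (Y →₀ D)) (RowFiniteMatrix Y D) := by
  let _ : TopologicalSpace (Y →₀ D) := ⊥
  have : DiscreteTopology (Y →₀ D) := ⟨rfl⟩
  let φ : EndOp D (Y →₀ D) ≃+* RowFiniteMatrix Y D :=
    { toFun := fun f y => f.apply (Finsupp.single y 1)
      invFun := fun a => EndOp.of (Finsupp.linearCombination D a.row)
      left_inv := fun f => by
        refine MulOpposite.unop_injective (Finsupp.lhom_ext' fun y => LinearMap.ext_ring ?_)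
        change Finsupp.linearCombination D _ (Finsupp.single y 1) = _
        rw [Finsupp.linearCombination_single, one_smul]
        rfl
      right_inv := fun a => by
        funext y
        change Finsupp.linearCombination D _ (Finsupp.single y 1) = _
        rw [Finsupp.linearCombination_single, one_smul]
        rfl
      map_mul' := fun f g => by
        funext y
        change g.apply (f.apply (Finsupp.single y 1)) = Finsupp.linearCombination D
          (fun z => g.apply (Finsupp.single z 1)) (f.apply (Finsupp.single y 1))
        generalize f.apply (Finsupp.single y 1) = v
        refine LinearMap.congr_fun (f := (MulOpposite.unop g : Module.End D (Y →₀ D))) ?_ v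
        refine Finsupp.lhom_ext' fun y => LinearMap.ext_ring ?_
        simp only [LinearMap.comp_apply, Finsupp.lsingle_apply, Finsupp.linearCombination_single,
          one_smul]
        rfl
      map_add' := fun f g => rfl }
  refine ⟨φ, ?_, ?_⟩
  · exact continuous_pi fun y => EndOp.continuous_apply _
  · refine EndOp.continuous_iff.2 fun v => ?_
    -- The image of `v` involves only the finitely many rows indexed by the support of `v`; hence it
    -- is locally constant in the matrix.
    induction v using Finsupp.induction_linear with
    | zero =>
      refine (continuous_const (y := (0 : Y →₀ D))).congr fun a => ?_
      exact (map_zero (Finsupp.linearCombination D a.row)).symm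
    | add f g hf hg =>
      refine (hf.add hg).congr fun a => ?_
      exact (map_add (Finsupp.linearCombination D a.row) f g).symm
    | single y d =>
      have h : Continuous fun a : RowFiniteMatrix Y D => d • a.row y :=
        (continuous_of_discreteTopology (f := fun v : Y →₀ D => d • v)).comp
          (_root_.continuous_apply (A := fun _ => Y →₀ D) y)
      refine h.congr fun a => ?_
      exact (Finsupp.linearCombination_single D d y).symm

end EndOp

/-! ### Decompositions of the unit into simple idempotents -/

/-- A family of nonzero orthogonal idempotents `eᵢ` with sum `1` that generate simple right
ideals. -/
structure IsSimpleDecomposition {S ι : Type*} [Ring S] [TopologicalSpace S] (e : ι → S) :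
    Prop where
  idem : ∀ i, e i * e i = e i
  orth : ∀ i j, i ≠ j → e i * e j = 0
  hasSum : HasSum e 1
  ne_zero : ∀ i, e i ≠ 0
  exists_mul : ∀ i a, e i * a ≠ 0 → ∃ b, e i * a * b = e i

lemma IsSimpleDecomposition.of_isTopRingIso {R T ι : Type*} [Ring R] [TopologicalSpace R]
    [Ring T] [TopologicalSpace T] (h : IsTopRingIso R T) {e : ι → T}
    (he : IsSimpleDecomposition e) : ∃ e : ι → R, IsSimpleDecomposition e := by
  obtain ⟨φ, -, hφ⟩ := h
  refine ⟨fun i => φ.symm (e i), fun i => ?_, fun i j hij => ?_, ?_, fun i hi => ?_,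
    fun i a ha => ?_⟩
  · rw [← map_mul, he.idem]
  · rw [← map_mul, he.orth i j hij, map_zero]
  · simpa [Function.comp_def] using he.hasSum.map φ.symm hφ
  · exact he.ne_zero i (by simpa using hi)
  · obtain ⟨b, hb⟩ := he.exists_mul i (φ a) fun h => ha <| by
      apply φ.injective; simpa using h
    refine ⟨φ.symm b, φ.injective ?_⟩
    simpa using hb

lemma IsSimpleDecomposition.pi {X : Type*} {κ : X → Type*} {T : X → Type*} [∀ x, Ring (T x)]
    [∀ x, TopologicalSpace (T x)] {e : ∀ x, κ x → T x} (he : ∀ x, IsSimpleDecomposition (e x)) :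
    ∃ e : (Σ x, κ x) → ∀ x, T x, IsSimpleDecomposition e := by
  classical
  refine ⟨fun p => Pi.single p.1 (e p.1 p.2), ?_, ?_, ?_, ?_, ?_⟩
  · rintro ⟨x, i⟩
    simp [← Pi.single_mul, (he x).idem]
  · rintro ⟨x, i⟩ ⟨y, j⟩ hij
    by_cases hxy : x = y
    · subst hxy
      have : i ≠ j := fun h => hij (by rw [h])
      simp [← Pi.single_mul, (he x).orth i j this]
    · ext z
      by_cases hz : z = x
      · subst hz
        simp [Pi.single_eq_of_ne hxy]
      · simp [Pi.single_eq_of_ne hz]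
  · refine Pi.hasSum.2 fun y => ?_
    have hinj : Function.Injective (Sigma.mk y : κ y → Σ x, κ x) := sigma_mk_injective
    refine (hinj.hasSum_iff ?_).1 ?_
    · rintro ⟨x, i⟩ hx
      refine Pi.single_eq_of_ne (fun h => hx ?_) _
      subst h
      exact ⟨i, rfl⟩
    · simpa [Function.comp_def] using (he y).hasSum
  · rintro ⟨x, i⟩ h
    exact (he x).ne_zero i (by simpa using h)
  · rintro ⟨x, i⟩ a ha
    have h1 : ∀ a : ∀ x, T x, Pi.single x (e x i) * a = Pi.single x (e x i * a x) := fun a => by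
      ext z
      by_cases hz : z = x
      · subst hz; simp
      · simp [Pi.single_eq_of_ne hz]
    obtain ⟨b, hb⟩ := (he x).exists_mul i (a x) fun h => ha (by
      change Pi.single x (e x i) * a = 0
      rw [h1, h, Pi.single_zero])
    refine ⟨Pi.single x b, ?_⟩
    change Pi.single x (e x i) * a * Pi.single x b = Pi.single x (e x i)
    rw [h1, ← Pi.single_mul, hb]

-- Orthogonal projections onto the simple summands. Their sum is `1` because a vector has finite
-- support. If `a` is nonzero on the image of a projection, it embeds that simple summand, and
-- semisimplicity of `M` extends the inverse embedding to an endomorphism `b` undoing `a` there.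
open Classical in
lemma EndOp.isSimpleDecomposition {A M ι : Type*} [Ring A] [AddCommGroup M] [Module A M]
    [IsSemisimpleModule A M] {N : ι → Type*} [∀ i, AddCommGroup (N i)] [∀ i, Module A (N i)]
    [∀ i, IsSimpleModule A (N i)] (φ : M ≃ₗ[A] Π₀ i, N i) :
    IsSimpleDecomposition fun i => EndOp.of (A := A)
      (φ.symm.toLinearMap ∘ₗ DFinsupp.lsingle i ∘ₗ DFinsupp.lapply i ∘ₗ φ.toLinearMap) := by
  refine ⟨fun i => ?_, fun i j hij => ?_, ?_, fun i h => ?_, fun i a ha => ?_⟩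
  · refine EndOp.ext fun m => ?_
    simp [EndOp.apply_mul]
  · refine EndOp.ext fun m => ?_
    simp [EndOp.apply_mul, EndOp.apply_zero, DFinsupp.single_apply, hij]
  · refine EndOp.tendsto_iff.2 fun m => ?_
    filter_upwards [eventually_ge_atTop (φ m).support] with s hs
    rw [EndOp.apply_sum, EndOp.apply_one]
    apply φ.injective
    simp only [EndOp.of_apply, LinearMap.comp_apply, LinearEquiv.coe_coe, map_sum,
      LinearEquiv.apply_symm_apply, DFinsupp.lapply_apply, DFinsupp.lsingle_apply]
    ext j
    rw [DFinsupp.finsetSum_apply]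
    simp only [DFinsupp.single_apply]
    rw [Finset.sum_dite_eq']
    split_ifs with hj
    · rfl
    · have : j ∉ (φ m).support := fun h => hj (hs h)
      simpa [eq_comm] using this
  · have := IsSimpleModule.nontrivial A (N i)
    obtain ⟨n, hn⟩ := exists_ne (0 : N i)
    have := congrArg (fun f : EndOp A M => φ (f.apply (φ.symm (DFinsupp.single i n))) i) h
    exact hn (by simpa [EndOp.apply_zero] using this)
  · set j : N i →ₗ[A] M := φ.symm.toLinearMap ∘ₗ DFinsupp.lsingle i with hj
    let f : Module.End A M := MulOpposite.unop a
    have hf : f ∘ₗ j ≠ 0 := fun h => ha <| EndOp.ext fun m =>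
      LinearMap.congr_fun h (φ m i)
    obtain ⟨g, hg⟩ := IsSemisimpleModule.extension_property _
      (LinearMap.injective_of_ne_zero hf) j
    exact ⟨EndOp.of g, EndOp.ext fun m => LinearMap.congr_fun hg (φ m i)⟩

lemma EndOp.exists_isSimpleDecomposition (A M : Type u) [Ring A] [AddCommGroup M] [Module A M]
    [IsSemisimpleModule A M] : ∃ (ι : Type u) (e : ι → EndOp A M), IsSimpleDecomposition e := by
  obtain ⟨s, φ, -, hs⟩ := IsSemisimpleModule.exists_linearEquiv_dfinsupp A M
  exact ⟨s, _, EndOp.isSimpleDecomposition φ⟩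

/-! ### Semisimplicity criteria -/

/-- Each nonzero multiple of `m` generates `m` back, so the span is zero or simple. All later
semisimplicity proofs write a module as a sum of such spans. -/
lemma isSemisimpleModule_span_singleton {R N : Type*} [Ring R] [AddCommGroup N] [Module R N]
    {m : N} (h : ∀ r : R, r • m ≠ 0 → ∃ t : R, t • r • m = m) :
    IsSemisimpleModule R (Submodule.span R {m}) := by
  by_cases hm : m = 0
  · subst hm
    rw [Submodule.span_zero_singleton]
    exact (isSemisimpleModule_iff _ _).2 ⟨fun a => ⟨⊥, by
      rw [Subsingleton.elim a ⊤]; exact isCompl_top_bot⟩⟩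
  · suffices IsSimpleModule R (Submodule.span R {m}) by infer_instance
    rw [isSimpleModule_iff_toSpanSingleton_surjective]
    refine ⟨⟨⟨m, Submodule.mem_span_singleton_self m⟩, 0, fun h => hm (congrArg Subtype.val h)⟩, ?_⟩
    rintro ⟨x, hx⟩ hx0 ⟨y, hy⟩
    obtain ⟨r, rfl⟩ := Submodule.mem_span_singleton.1 hx
    obtain ⟨s, rfl⟩ := Submodule.mem_span_singleton.1 hy
    obtain ⟨t, ht⟩ := h r fun h0 => hx0 (Subtype.ext h0)
    refine ⟨s * t, Subtype.ext ?_⟩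
    change (s * t) • r • m = s • m
    rw [mul_smul, ht]

/-- For `m` in a simple submodule `N`, an endomorphism that does not kill `m` is injective on `N`,
and by semisimplicity it has a left inverse on `N`. So `m` generates a simple or zero module over
the endomorphism ring, and such `m` span `M`. -/
instance isSemisimpleModule_moduleEnd {R M : Type*} [Ring R] [AddCommGroup M] [Module R M]
    [IsSemisimpleModule R M] : IsSemisimpleModule (Module.End R M) M := by
  let P := {p : Submodule R M × M // IsSimpleModule R p.1 ∧ p.2 ∈ p.1}
  refine isSemisimpleModule_of_isSemisimpleModule_submodule'
    (p := fun p : P => Submodule.span (Module.End R M) {p.1.2}) ?_ ?_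
  · rintro ⟨⟨N, m⟩, hN, hm⟩
    refine isSemisimpleModule_span_singleton fun f hf => ?_
    have : f ∘ₗ N.subtype ≠ 0 := fun h => hf (LinearMap.congr_fun h ⟨m, hm⟩)
    obtain ⟨g, hg⟩ := IsSemisimpleModule.extension_property _
      (LinearMap.injective_of_ne_zero this) N.subtype
    exact ⟨g, LinearMap.congr_fun hg ⟨m, hm⟩⟩
  · rw [eq_top_iff]
    intro m _
    have hm : m ∈ sSup {N : Submodule R M | IsSimpleModule R N} := by
      rw [IsSemisimpleModule.sSup_simples_eq_top]; trivial
    rw [sSup_eq_iSup'] at hm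
    refine Submodule.iSup_induction _ (motive := fun m => m ∈ ⨆ p : P, Submodule.span
      (Module.End R M) {p.1.2}) hm ?_ (zero_mem _) fun _ _ => add_mem
    rintro ⟨N, hN⟩ m hm
    exact Submodule.mem_iSup_of_mem (⟨⟨N, m⟩, hN, hm⟩ : P) (Submodule.mem_span_singleton_self m)

/-! ### Discrete modules -/

section

variable (S : Type u) [Ring S] [TopologicalSpace S] [IsTopologicalRing S]

/-- The filter of open right ideals. -/
def openIdeals : Order.PFilter (Ideal Sᵐᵒᵖ) :=
  Order.IsPFilter.toPFilter (F := {I | IsOpen {s : S | MulOpposite.op s ∈ I}})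
    (Order.IsPFilter.of_def ⟨⊤, by simp⟩
      (fun I hI J hJ => ⟨I ⊓ J, hI.inter hJ, inf_le_left, inf_le_right⟩)
      (fun {I J} hIJ hI => AddSubgroup.isOpen_mono
        (H₁ := I.toAddSubgroup.comap (MulOpposite.opAddEquiv (α := S)).toAddMonoidHom)
        (H₂ := J.toAddSubgroup.comap (MulOpposite.opAddEquiv (α := S)).toAddMonoidHom)
        (fun _ h => hIJ h) hI))

lemma isDiscreteModule_eq : isDiscreteModule S = torsionClass (openIdeals S) := rfl

lemma isSplitCategory_discr_iff : IsSplitCategory (Discr S) ↔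
    ∀ X : Discr S, IsSemisimpleModule Sᵐᵒᵖ X.obj :=
  torsionClass_isSplitCategory_iff (F := openIdeals S)

lemma isSemisimpleCategory_discr_iff : IsSemisimpleCategory (Discr S) ↔
    ∀ X : Discr S, IsSemisimpleModule Sᵐᵒᵖ X.obj :=
  torsionClass_isSemisimpleCategory_iff (F := openIdeals S)

variable {S}

/-- Partial sums of the idempotents eventually act as the identity on a given vector, because its
annihilator is open. The components of the vector generate zero or simple submodules by
`exists_mul`. -/
lemma IsSimpleDecomposition.isSemisimpleModule_discr {ι : Type u} {e : ι → S}
    (he : IsSimpleDecomposition e) (X : Discr S) : IsSemisimpleModule Sᵐᵒᵖ X.obj := by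
  refine isSemisimpleModule_of_isSemisimpleModule_submodule'
    (p := fun p : ι × X.obj => Submodule.span Sᵐᵒᵖ {MulOpposite.op (e p.1) • p.2}) ?_ ?_
  · rintro ⟨i, n⟩
    refine isSemisimpleModule_span_singleton fun a ha => ?_
    rw [smul_smul] at ha
    obtain ⟨b, hb⟩ := he.exists_mul i a.unop fun h => ha (by
      rw [show a * MulOpposite.op (e i) = MulOpposite.op (e i * a.unop) from rfl, h]; simp)
    refine ⟨MulOpposite.op b, ?_⟩
    rw [smul_smul, smul_smul]
    rw [mul_assoc] at hb
    change MulOpposite.op (e i * (a.unop * b)) • n = MulOpposite.op (e i) • n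
    rw [hb]
  · rw [eq_top_iff]
    intro n _
    have hopen : {s : S | MulOpposite.op (1 - s) • n = 0} ∈ 𝓝 (1 : S) := by
      refine IsOpen.mem_nhds ((X.property n).preimage (continuous_const.sub continuous_id)) ?_
      simp
    obtain ⟨s, hs⟩ := (he.hasSum.eventually hopen).exists
    have hn : n = ∑ i ∈ s, MulOpposite.op (e i) • n := by
      rw [MulOpposite.op_sub, sub_smul, MulOpposite.op_one, one_smul, sub_eq_zero] at hs
      conv_lhs => rw [hs]
      rw [Finset.op_sum, Finset.sum_smul]
    rw [hn]
    exact sum_mem fun i _ => Submodule.mem_iSup_of_mem (i, n) (Submodule.mem_span_singleton_self _)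

variable (S) in
/-- Representatives of the isomorphism classes of simple discrete modules. -/
lemma exists_simple_representatives : ∃ (X : Type u) (T : X → Discr S),
    (∀ x, IsSimpleModule Sᵐᵒᵖ (T x).obj) ∧
    (∀ x y, Nonempty ((T x).obj ≃ₗ[Sᵐᵒᵖ] (T y).obj) → x = y) ∧
    ∀ N : Discr S, IsSimpleModule Sᵐᵒᵖ N.obj → ∃ x, Nonempty (N.obj ≃ₗ[Sᵐᵒᵖ] (T x).obj) := by
  -- Every simple module is a quotient of the ring, so quotients by ideals supply a small set of
  -- candidates.
  let Λ := {I : Ideal Sᵐᵒᵖ // isDiscreteModule S (ModuleCat.of Sᵐᵒᵖ (Sᵐᵒᵖ ⧸ I)) ∧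
    IsSimpleModule Sᵐᵒᵖ (Sᵐᵒᵖ ⧸ I)}
  let r : Setoid Λ :=
    { r := fun I J => Nonempty ((Sᵐᵒᵖ ⧸ I.1) ≃ₗ[Sᵐᵒᵖ] (Sᵐᵒᵖ ⧸ J.1))
      iseqv := ⟨fun I => ⟨.refl _ _⟩, fun ⟨e⟩ => ⟨e.symm⟩, fun ⟨e⟩ ⟨f⟩ => ⟨e.trans f⟩⟩ }
  refine ⟨Quotient r, fun x => ⟨ModuleCat.of Sᵐᵒᵖ (Sᵐᵒᵖ ⧸ x.out.1), x.out.2.1⟩,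
    fun x => x.out.2.2, fun x y h => ?_, fun N hN => ?_⟩
  · rw [← x.out_eq, ← y.out_eq]
    exact Quotient.sound h
  · obtain ⟨I, -, ⟨e⟩⟩ := isSimpleModule_iff_quot_maximal.1 hN
    let J : Λ := ⟨I, torsionClass_of_injective (F := openIdeals S) e.symm.toLinearMap
      e.symm.injective N.property, IsSimpleModule.congr e.symm⟩
    obtain ⟨f⟩ : Nonempty ((Sᵐᵒᵖ ⧸ (Quotient.mk r J).out.1) ≃ₗ[Sᵐᵒᵖ] (Sᵐᵒᵖ ⧸ I)) :=
      Quotient.mk_out J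
    exact ⟨Quotient.mk r J, ⟨e.trans f.symm⟩⟩

/-- The right action of a ring on a module commuting with a left action. -/
def actionHom (S D N : Type*) [Ring S] [Ring D] [AddCommGroup N] [Module D N] [Module Sᵐᵒᵖ N]
    [SMulCommClass Sᵐᵒᵖ D N] : S →+* EndOp D N where
  toFun s := EndOp.of (Module.toModuleEnd D N (MulOpposite.op s))
  map_one' := EndOp.ext fun m => one_smul _ m
  map_mul' s t := EndOp.ext fun m => mul_smul (MulOpposite.op t) (MulOpposite.op s) m
  map_zero' := EndOp.ext fun m => zero_smul _ m
  map_add' s t := EndOp.ext fun m => add_smul (MulOpposite.op s) (MulOpposite.op t) m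

@[simp] lemma actionHom_apply {S D N : Type*} [Ring S] [Ring D] [AddCommGroup N] [Module D N]
    [Module Sᵐᵒᵖ N] [SMulCommClass Sᵐᵒᵖ D N] (s : S) (n : N) :
    (actionHom S D N s).apply n = MulOpposite.op s • n := rfl

lemma continuous_actionHom {D : Type*} {N : Type u} [Ring D] [AddCommGroup N] [Module D N]
    [Module Sᵐᵒᵖ N] [SMulCommClass Sᵐᵒᵖ D N]
    (hN : isDiscreteModule S (ModuleCat.of Sᵐᵒᵖ N)) : Continuous (actionHom S D N) := by
  refine continuous_of_continuousAt_zero _ ?_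
  rw [ContinuousAt, map_zero]
  exact EndOp.tendsto_iff.2 fun n => (hN n).mem_nhds (by simp)

lemma isDiscreteModule_dfinsupp {X : Type u} {T : X → Type u} [∀ x, AddCommGroup (T x)]
    [∀ x, Module Sᵐᵒᵖ (T x)] (hT : ∀ x, isDiscreteModule S (ModuleCat.of Sᵐᵒᵖ (T x))) :
    isDiscreteModule S (ModuleCat.of Sᵐᵒᵖ (Π₀ x, T x)) := by
  classical
  rw [isDiscreteModule_eq]
  intro m
  change Π₀ x, T x at m
  induction m using DFinsupp.induction with
  | h0 => exact torsionClass_zero_mem _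
  | ha x t m _ _ ih =>
    refine torsionClass_add_mem _ ?_ ih
    refine Order.PFilter.mem_of_le (F := openIdeals S) (fun r hr => ?_)
      (show LinearMap.ker (LinearMap.toSpanSingleton Sᵐᵒᵖ (T x) t) ∈ openIdeals S from hT x t)
    simp only [LinearMap.mem_ker, LinearMap.toSpanSingleton_apply] at hr ⊢
    rw [← DFinsupp.single_smul, hr, DFinsupp.single_zero]

/-- A ring topology is defined by discrete modules `T x` if the annihilators of finite sets of
their elements form a base of neighborhoods of zero. -/
def SeparatesByAnnihilators {X : Type u} (T : X → Discr S) : Prop :=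
  ∀ U ∈ 𝓝 (0 : S), ∃ s : Finset (Σ x, (T x).obj), ∀ a : S,
    (∀ p ∈ s, MulOpposite.op a • p.2 = 0) → a ∈ U

/-- For an open right ideal `I` the discrete module `S ⧸ I` is semisimple, and the class of `1` has
finitely many nonzero simple components. An element killing these components kills the class of `1`,
so it lies in `I`. -/
lemma separatesByAnnihilators [IsLinearTopology Sᵐᵒᵖ S]
    (hS : ∀ X : Discr S, IsSemisimpleModule Sᵐᵒᵖ X.obj) {X : Type u} {T : X → Discr S}
    (hT : ∀ N : Discr S, IsSimpleModule Sᵐᵒᵖ N.obj → ∃ x, Nonempty (N.obj ≃ₗ[Sᵐᵒᵖ] (T x).obj)) :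
    SeparatesByAnnihilators T := by
  classical
  intro U hU
  obtain ⟨I, hI, hIU⟩ := (IsLinearTopology.hasBasis_open_submodule Sᵐᵒᵖ).mem_iff.1 hU
  let N : Discr S := ⟨ModuleCat.of Sᵐᵒᵖ (S ⧸ I), fun n => by
    obtain ⟨s, rfl⟩ := I.mkQ_surjective n
    have h : {a : S | MulOpposite.op a • I.mkQ s = 0} = (fun a => s * a) ⁻¹' I := by
      ext a
      rw [Set.mem_ofPred_eq, ← map_smul]
      exact Submodule.Quotient.mk_eq_zero I
    rw [h]
    exact hI.preimage (continuous_const.mul continuous_id)⟩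
  have : IsSemisimpleModule Sᵐᵒᵖ (S ⧸ I) := hS N
  obtain ⟨t, φ, -, ht⟩ := IsSemisimpleModule.exists_linearEquiv_dfinsupp Sᵐᵒᵖ (S ⧸ I)
  have hx : ∀ m : t, ∃ x, Nonempty (m.1 ≃ₗ[Sᵐᵒᵖ] (T x).obj) := fun m =>
    hT ⟨ModuleCat.of Sᵐᵒᵖ m.1, torsionClass_of_injective (F := openIdeals S) m.1.subtype
      m.1.subtype_injective N.property⟩ (ht m)
  choose x hx using hx
  let ψ : ∀ m : t, m.1 ≃ₗ[Sᵐᵒᵖ] (T (x m)).obj := fun m => (hx m).some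
  let n : Π₀ m : t, m.1 := φ (I.mkQ 1)
  refine ⟨n.support.image fun m => ⟨x m, ψ m (n m)⟩, fun a ha => hIU ?_⟩
  have h0 : MulOpposite.op a • n = 0 := by
    ext1 m
    by_cases hm : m ∈ n.support
    · have := ha _ (Finset.mem_image_of_mem _ hm)
      simp only [← map_smul, LinearEquiv.map_eq_zero_iff] at this
      simpa using this
    · rw [DFinsupp.notMem_support_iff] at hm
      simp [hm]
  have h1 : MulOpposite.op a • I.mkQ 1 = 0 := by
    apply φ.injective
    rw [map_smul, map_zero]
    exact h0
  rw [← map_smul] at h1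
  have := (Submodule.Quotient.mk_eq_zero I).1 h1
  simpa using this

end

/-- The hypothesis on neighborhoods does double duty: applied to the complement of a point it gives
injectivity, and in general it is continuity of the inverse at zero. -/
lemma isTopRingIso_of_surjective {S T : Type*} [Ring S] [TopologicalSpace S]
    [IsTopologicalAddGroup S] [T1Space S] [Ring T] [TopologicalSpace T]
    [IsTopologicalAddGroup T] (ρ : S →+* T) (hρ : Continuous ρ) (hsurj : Function.Surjective ρ)
    (hU : ∀ U ∈ 𝓝 (0 : S), ∃ V ∈ 𝓝 (0 : T), ∀ a, ρ a ∈ V → a ∈ U) : IsTopRingIso S T := by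
  have hinj : Function.Injective ρ := by
    rw [injective_iff_map_eq_zero]
    intro a ha
    by_contra hne
    obtain ⟨V, hV, h⟩ := hU {a}ᶜ (isOpen_compl_singleton.mem_nhds (Ne.symm hne))
    exact h a (ha ▸ mem_of_mem_nhds hV) rfl
  let e := RingEquiv.ofBijective ρ ⟨hinj, hsurj⟩
  refine ⟨e, hρ, continuous_of_continuousAt_zero e.symm ?_⟩
  rw [ContinuousAt, map_zero]
  intro U hU'
  obtain ⟨V, hV, h⟩ := hU U hU'
  refine mem_map.2 (mem_of_superset hV fun t ht => h _ ?_)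
  change e (e.symm t) ∈ V
  rwa [e.apply_symm_apply]

/-! ### Density and the reconstruction of a complete ring from its simple discrete modules -/

section

variable {S : Type u} [Ring S] [UniformSpace S] [IsUniformAddGroup S] [IsTopologicalRing S]
  [CompleteSpace S]

/-- Density theorem for complete rings. -/
lemma exists_smul_eq_of_separates {M : Type u} [AddCommGroup M] [Module Sᵐᵒᵖ M]
    [IsSemisimpleModule Sᵐᵒᵖ M] (hM : isDiscreteModule S (ModuleCat.of Sᵐᵒᵖ M))
    (hU : ∀ U ∈ 𝓝 (0 : S), ∃ s : Finset M, ∀ a : S,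
      (∀ m ∈ s, MulOpposite.op a • m = 0) → a ∈ U)
    (f : Module.End (Module.End Sᵐᵒᵖ M) M) : ∃ a : S, ∀ m, f m = MulOpposite.op a • m := by
  classical
  -- Density realizes `f` on each finite set by a ring element. Two such elements that agree with
  -- `f` on `s` differ by an annihilator of `s`, so the net is Cauchy.
  choose r hr using fun s : Finset M => jacobson_density f s
  let a : Finset M → S := fun s => (r s).unop
  have ha : ∀ s, ∀ m ∈ s, f m = MulOpposite.op (a s) • m := hr
  have hcauchy : CauchySeq a := by
    have hbasis := (𝓝 (0 : S)).basis_sets.comap fun x : S × S => x.2 - x.1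
    rw [← uniformity_eq_comap_nhds_zero S] at hbasis
    rw [hbasis.cauchySeq_iff]
    intro U hU'
    obtain ⟨s, hs⟩ := hU U hU'
    refine ⟨s, fun m hm n hn => hs _ fun y hy => ?_⟩
    rw [MulOpposite.op_sub, sub_smul, ← ha _ y (hn hy), ← ha _ y (hm hy), sub_self]
  obtain ⟨b, hb⟩ := cauchySeq_tendsto_of_complete hcauchy
  refine ⟨b, fun m => ?_⟩
  -- The annihilator of `m` is open, so the limit acts on `m` like the late terms of the net.
  have hopen : {c : S | MulOpposite.op (b - c) • m = 0} ∈ 𝓝 b := by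
    refine IsOpen.mem_nhds ((hM m).preimage (continuous_const.sub continuous_id)) ?_
    simp
  obtain ⟨s, hs1, hs2⟩ := ((hb.eventually hopen).and (eventually_ge_atTop {m})).exists
  rw [ha s m (hs2 (by simp))]
  rw [MulOpposite.op_sub, sub_smul, sub_eq_zero] at hs1
  exact hs1.symm

end

section

variable {S : Type u} [Ring S] [UniformSpace S] [IsUniformAddGroup S] [IsTopologicalRing S]
  [IsLinearTopology Sᵐᵒᵖ S] [CompleteSpace S] [T2Space S]

lemma SeparatesByAnnihilators.exists_smul_eq {X : Type u} {T : X → Discr S}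
    (h : SeparatesByAnnihilators T) [∀ x, IsSimpleModule Sᵐᵒᵖ (T x).obj]
    (f : Module.End (Module.End Sᵐᵒᵖ (Π₀ x, (T x).obj)) (Π₀ x, (T x).obj)) :
    ∃ a : S, ∀ m, f m = MulOpposite.op a • m := by
  classical
  refine exists_smul_eq_of_separates (isDiscreteModule_dfinsupp fun x => (T x).property)
    (fun U hU => ?_) f
  obtain ⟨s, hs⟩ := h U hU
  refine ⟨s.image fun p => DFinsupp.single p.1 p.2, fun a ha => hs a fun p hp => ?_⟩
  have := ha _ (Finset.mem_image_of_mem _ hp)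
  rw [← DFinsupp.single_smul] at this
  exact (DFinsupp.single_eq_zero (β := fun x => (T x).obj)).1 this

/-- Surjectivity is the double centralizer property given by density and completeness; the
topologies match because a finite set of vectors in the summands generates a finitely generated
submodule of the direct sum. -/
lemma SeparatesByAnnihilators.isTopRingIso_endOp {X : Type u} {T : X → Discr S}
    (h : SeparatesByAnnihilators T) [∀ x, IsSimpleModule Sᵐᵒᵖ (T x).obj] :
    IsTopRingIso S (EndOp (Module.End Sᵐᵒᵖ (Π₀ x, (T x).obj)) (Π₀ x, (T x).obj)) := by
  classical
  refine isTopRingIso_of_surjective (actionHom S _ _)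
    (continuous_actionHom (isDiscreteModule_dfinsupp fun x => (T x).property)) ?_ ?_
  · intro f
    obtain ⟨a, ha⟩ := h.exists_smul_eq (MulOpposite.unop f)
    exact ⟨a, EndOp.ext fun m => (ha m).symm⟩
  · intro U hU
    obtain ⟨s, hs⟩ := h U hU
    refine ⟨_, (EndOp.hasBasis_nhds_zero _ _).mem_of_mem
      (i := Submodule.span _ (s.image fun p => DFinsupp.single p.1 p.2 : Finset (Π₀ x, (T x).obj)))
      (Submodule.fg_span (Finset.finite_toSet _)), fun a ha => hs a fun p hp => ?_⟩
    have := ha _ (Submodule.subset_span (Finset.mem_image_of_mem _ hp))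
    rw [actionHom_apply, ← DFinsupp.single_smul] at this
    exact (DFinsupp.single_eq_zero (β := fun x => (T x).obj)).1 this

lemma SeparatesByAnnihilators.isTopRingIso_pi {X : Type u} {T : X → Discr S}
    (h : SeparatesByAnnihilators T) [∀ x, IsSimpleModule Sᵐᵒᵖ (T x).obj]
    (hT : ∀ x y, Nonempty ((T x).obj ≃ₗ[Sᵐᵒᵖ] (T y).obj) → x = y) :
    IsTopRingIso S (∀ x, EndOp (Module.End Sᵐᵒᵖ (T x).obj) (T x).obj) := by
  classical
  refine isTopRingIso_of_surjective
    (RingHom.pi fun x => actionHom S (Module.End Sᵐᵒᵖ (T x).obj) (T x).obj)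
    (continuous_pi fun x => continuous_actionHom (T x).property) ?_ ?_
  · intro φ
    let Φ : (Π₀ x, (T x).obj) →+ Π₀ x, (T x).obj :=
      DFinsupp.mapRange.addMonoidHom fun x =>
        (LinearMap.toAddMonoidHom (MulOpposite.unop (φ x) : Module.End _ (T x).obj))
    have hΦ : ∀ x t, Φ (DFinsupp.single x t) = DFinsupp.single x ((φ x).apply t) := fun x t =>
      DFinsupp.mapRange_single (hf := fun x => map_zero _)
    -- Distinct `T x` are not isomorphic, so Schur's lemma makes every endomorphism of the direct
    -- sum diagonal. Any family `φ` of commuting actions therefore acts in the bicommutant.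
    have hg : ∀ (g : Module.End Sᵐᵒᵖ (Π₀ x, (T x).obj)) (x : X), ∃ d : Module.End Sᵐᵒᵖ (T x).obj,
        ∀ t, g (DFinsupp.single x t) = DFinsupp.single x (d t) := fun g x => by
      refine ⟨DFinsupp.lapply x ∘ₗ g ∘ₗ
        DFinsupp.lsingle (R := Sᵐᵒᵖ) (M := fun x => (T x).obj) x, fun t => ?_⟩
      ext1 y
      by_cases hy : y = x
      · subst hy; simp
      · rw [DFinsupp.single_eq_of_ne hy]
        let k : (T x).obj →ₗ[Sᵐᵒᵖ] (T y).obj := DFinsupp.lapply y ∘ₗ g ∘ₗ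
          DFinsupp.lsingle (R := Sᵐᵒᵖ) (M := fun x => (T x).obj) x
        rcases k.bijective_or_eq_zero with hk | hk
        · exact absurd (hT x y ⟨LinearEquiv.ofBijective k hk⟩).symm hy
        · exact LinearMap.congr_fun hk t
    let F : Module.End (Module.End Sᵐᵒᵖ (Π₀ x, (T x).obj)) (Π₀ x, (T x).obj) :=
      { toFun := Φ
        map_add' := Φ.map_add
        map_smul' := fun g m => by
          simp only [Module.End.smul_def, RingHom.id_apply]
          induction m using DFinsupp.induction with
          | h0 => simp
          | ha x t m _ _ ih =>
            simp only [map_add, ih]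
            congr 1
            obtain ⟨d, hd⟩ := hg g x
            rw [hΦ, hd, hd, hΦ]
            congr 1
            exact (MulOpposite.unop (φ x) : Module.End _ (T x).obj).map_smul d t }
    obtain ⟨a, ha⟩ := h.exists_smul_eq F
    refine ⟨a, funext fun x => EndOp.ext fun t => ?_⟩
    have := ha (DFinsupp.single x t)
    rw [← DFinsupp.single_smul] at this
    exact (DFinsupp.single_injective ((hΦ x t).symm.trans this)).symm
  · intro U hU
    obtain ⟨s, hs⟩ := h U hU
    refine ⟨⋂ p ∈ s, {φ | (φ p.1).apply p.2 = 0}, ?_, fun a ha => hs a fun p hp => ?_⟩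
    · refine (biInter_finset_mem s).2 fun p _ => ?_
      exact EndOp.tendsto_iff.1 ((continuous_apply p.1).tendsto
        (0 : ∀ x, EndOp (Module.End Sᵐᵒᵖ (T x).obj) (T x).obj)) p.2
    · exact Set.mem_iInter₂.1 ha p hp

lemma exists_isTopRingIso_endOp (hS : ∀ X : Discr S, IsSemisimpleModule Sᵐᵒᵖ X.obj) :
    ∃ (A M : Type u) (_ : Ring A) (_ : AddCommGroup M) (_ : Module A M),
      IsSemisimpleModule A M ∧ IsTopRingIso S (EndOp A M) := by
  obtain ⟨X, T, hT, -, hT'⟩ := exists_simple_representatives S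
  exact ⟨_, _, _, _, _, inferInstance, (separatesByAnnihilators hS hT').isTopRingIso_endOp⟩

lemma exists_isTopRingIso_pi_endOp (hS : ∀ X : Discr S, IsSemisimpleModule Sᵐᵒᵖ X.obj) :
    ∃ (X : Type u) (Y : X → Type u) (D : X → Type u) (_ : ∀ x, DivisionRing (D x)),
      (∀ x, Nonempty (Y x)) ∧ IsTopRingIso S (∀ x, EndOp (D x) (Y x →₀ D x)) := by
  classical
  obtain ⟨X, T, hT, hT', hT''⟩ := exists_simple_representatives S
  let b := fun x => Module.Basis.ofVectorSpace (Module.End Sᵐᵒᵖ (T x).obj) (T x).obj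
  refine ⟨X, fun x => Module.Basis.ofVectorSpaceIndex (Module.End Sᵐᵒᵖ (T x).obj) (T x).obj,
    fun x => Module.End Sᵐᵒᵖ (T x).obj, fun x => inferInstance, fun x => ?_, ?_⟩
  · have := IsSimpleModule.nontrivial Sᵐᵒᵖ (T x).obj
    exact (b x).index_nonempty
  · exact ((separatesByAnnihilators hS hT'').isTopRingIso_pi hT').trans
      (.pi fun x => EndOp.isTopRingIso_of_linearEquiv (b x).repr)

end

/-! ### The module of formal sums -/

namespace FormalSum

section

variable {S : Type u} [Ring S] [TopologicalSpace S] [IsTopologicalRing S] {X : Type u}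

instance : Add (FormalSum S X) :=
  ⟨fun a b => ⟨fun x => a.coeff x + b.coeff x, by
    simpa using a.tendsto_zero.add b.tendsto_zero⟩⟩

instance : Neg (FormalSum S X) :=
  ⟨fun a => ⟨fun x => - a.coeff x, by simpa using a.tendsto_zero.neg⟩⟩

instance : Sub (FormalSum S X) :=
  ⟨fun a b => ⟨fun x => a.coeff x - b.coeff x, by
    simpa using a.tendsto_zero.sub b.tendsto_zero⟩⟩

instance : SMul S (FormalSum S X) :=
  ⟨fun s a => ⟨fun x => s * a.coeff x, by simpa using a.tendsto_zero.const_mul s⟩⟩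

instance : SMul ℕ (FormalSum S X) :=
  ⟨fun n a => ⟨fun x => n • a.coeff x, by simpa using a.tendsto_zero.const_smul n⟩⟩

instance : SMul ℤ (FormalSum S X) :=
  ⟨fun n a => ⟨fun x => n • a.coeff x, by simpa using a.tendsto_zero.const_smul n⟩⟩

lemma coeff_injective : Function.Injective (coeff : FormalSum S X → X → S) :=
  fun _ _ h => FormalSum.ext h

instance : AddCommGroup (FormalSum S X) :=
  coeff_injective.addCommGroup _ rfl (fun _ _ => rfl) (fun _ => rfl) (fun _ _ => rfl)
    (fun _ _ => rfl) (fun _ _ => rfl)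

variable (S X) in
/-- The coefficients of formal sums as a homomorphism of groups. -/
def coeffHom : FormalSum S X →+ (X → S) where
  toFun := coeff
  map_zero' := rfl
  map_add' _ _ := rfl

instance : Module S (FormalSum S X) :=
  coeff_injective.module S (coeffHom S X) fun _ _ => rfl

@[simp] lemma add_coeff (a b : FormalSum S X) (x : X) :
    (a + b).coeff x = a.coeff x + b.coeff x := rfl

@[simp] lemma smul_coeff (s : S) (a : FormalSum S X) (x : X) :
    (s • a).coeff x = s * a.coeff x := rfl

lemma sum_coeff {ι : Type*} (F : Finset ι) (a : ι → FormalSum S X) (x : X) :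
    (∑ i ∈ F, a i).coeff x = ∑ i ∈ F, (a i).coeff x := by
  have := congrFun (map_sum (coeffHom S X) a F) x
  rw [Finset.sum_apply] at this
  exact this

lemma eq_sum_point (a : FormalSum S X) (F : Finset X) (hF : ∀ x ∉ F, a.coeff x = 0) :
    a = ∑ x ∈ F, a.coeff x • point S x := by
  classical
  ext y
  rw [sum_coeff]
  simp only [smul_coeff, point_coeff, mul_ite, mul_one, mul_zero, Finset.sum_ite_eq]
  split_ifs with hy
  · rfl
  · exact hF y hy

end

variable {S : Type u} [Ring S] [UniformSpace S] [IsUniformAddGroup S] [IsTopologicalRing S]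
  [IsLinearTopology Sᵐᵒᵖ S] {X Y : Type u}

/-- Open right ideals absorb right factors, so no condition on `g` is needed. -/
lemma tendsto_zero_mul_right {ι : Type*} {f : ι → S} (hf : Tendsto f cofinite (𝓝 0)) (g : ι → S) :
    Tendsto (fun i => f i * g i) cofinite (𝓝 0) :=
  IsLinearTopology.tendsto_smul_zero Sᵐᵒᵖ (fun i => MulOpposite.op (g i)) _ hf

variable [CompleteSpace S] [T2Space S]

lemma summable_mul_right {ι : Type*} {f : ι → S} (hf : Tendsto f cofinite (𝓝 0)) (g : ι → S) :
    Summable fun i => f i * g i :=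
  summable_of_tendsto (tendsto_zero_mul_right hf g)

lemma bind_coeff (a : FormalSum S X) (k : X → FormalSum S Y) (y : Y) :
    (a.bind k).coeff y = ∑' x, a.coeff x * (k x).coeff y := rfl

lemma add_bind (a b : FormalSum S X) (k : X → FormalSum S Y) :
    (a + b).bind k = a.bind k + b.bind k := by
  ext y
  simp only [bind_coeff, add_coeff, add_mul]
  exact (summable_mul_right a.tendsto_zero _).tsum_add (summable_mul_right b.tendsto_zero _)

lemma smul_bind (s : S) (a : FormalSum S X) (k : X → FormalSum S Y) :
    (s • a).bind k = s • a.bind k := by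
  ext y
  simp only [bind_coeff, smul_coeff, mul_assoc]
  exact (summable_mul_right a.tendsto_zero _).tsum_mul_left s

/-- Substitution into a formal sum as a linear map. -/
def bindHom (k : X → FormalSum S Y) : FormalSum S X →ₗ[S] FormalSum S Y where
  toFun a := a.bind k
  map_add' a b := add_bind a b k
  map_smul' s a := smul_bind s a k

end FormalSum

/-! ### The module structure of a contramodule -/

section Contra

variable {S : Type u} [Ring S] [UniformSpace S] [IsUniformAddGroup S] [IsTopologicalRing S]
  [IsLinearTopology Sᵐᵒᵖ S] [CompleteSpace S] [T2Space S]

open FormalSum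

/-- The infinite linear combination `∑ aₓ cₓ` in a contramodule. -/
def contraSum (C : Contra S) {X : Type u} (a : FormalSum S X) (c : X → C.A) : C.A :=
  contraaction C (a.map c)

lemma contraaction_point (C : Contra S) (c : C.A) : contraaction C (point S c) = c :=
  ConcreteCategory.congr_hom C.unit c

lemma contraSum_id (C : Contra S) (a : FormalSum S C.A) : contraSum C a id = contraaction C a := by
  rw [contraSum]
  exact congrArg _ (bind_point a)

lemma contraSum_point (C : Contra S) {X : Type u} (x : X) (c : X → C.A) :
    contraSum C (point S x) c = c x := by
  rw [contraSum, FormalSum.map, point_bind, contraaction_point]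

/-- Associativity of the contraaction, with the elements `c x` presented by chosen formal sums `k
x`. -/
lemma contraSum_contraaction (C : Contra S) {X : Type u} (a : FormalSum S X)
    (k : X → FormalSum S C.A) :
    contraSum C a (fun x => contraaction C (k x)) = contraaction C (a.bind k) := by
  have h := contraaction_join C (a.map k)
  simp only [FormalSum.map, FormalSum.join, FormalSum.bind_assoc, point_bind, id] at h
  exact h.symm

lemma contraSum_bind (C : Contra S) {X Y : Type u} (a : FormalSum S X) (k : X → FormalSum S Y)
    (c : Y → C.A) : contraSum C (a.bind k) c = contraSum C a fun x => contraSum C (k x) c := by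
  change _ = contraSum C a fun x => contraaction C ((k x).map c)
  rw [contraSum_contraaction, contraSum]
  simp only [FormalSum.map, FormalSum.bind_assoc]

lemma hom_contraSum {B C : Contra S} (f : B ⟶ C) {X : Type u} (a : FormalSum S X) (c : X → B.A) :
    f.f (contraSum B a c) = contraSum C a fun x => f.f (c x) := by
  rw [contraSum, ← hom_contraaction, contraSum]
  simp only [FormalSum.map, FormalSum.bind_assoc, point_bind]

lemma contraaction_surjective (C : Contra S) : Function.Surjective (contraaction C) :=
  fun c => ⟨point S c, contraaction_point C c⟩

lemma contraaction_congr {C : Contra S} {Z : Type u} {t : FormalSum S Z}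
    (k l : Z → FormalSum S C.A) (h : ∀ z, contraaction C (k z) = contraaction C (l z)) :
    contraaction C (t.bind k) = contraaction C (t.bind l) := by
  rw [← contraSum_contraaction, ← contraSum_contraaction]
  exact congrArg _ (funext h)

instance (C : Contra S) : Zero C.A := ⟨contraaction C 0⟩

instance (C : Contra S) : Add C.A := ⟨fun c d => contraaction C (point S c + point S d)⟩

instance (C : Contra S) : Neg C.A := ⟨fun c => contraaction C (-point S c)⟩

instance (C : Contra S) : Sub C.A := ⟨fun c d => contraaction C (point S c - point S d)⟩

instance (C : Contra S) : SMul S C.A := ⟨fun s c => contraaction C (s • point S c)⟩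

instance (C : Contra S) : SMul ℕ C.A := ⟨fun s c => contraaction C (s • point S c)⟩

instance (C : Contra S) : SMul ℤ C.A := ⟨fun s c => contraaction C (s • point S c)⟩

/-- Associativity again: evaluated at combinations of points such as `point S a + point S b` it says
that the contraaction respects each operation. Hence the module structure descends from formal sums
along the surjective contraaction. -/
lemma contraaction_bindHom (C : Contra S) (t : FormalSum S (FormalSum S C.A)) :
    contraaction C (bindHom (fun a => point S (contraaction C a)) t) =
      contraaction C (bindHom id t) := by
  refine contraaction_congr _ _ fun a => ?_
  rw [contraaction_point]
  rfl

lemma bindHom_point {X Y : Type u} (k : X → FormalSum S Y) (x : X) :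
    bindHom k (point S x) = k x := point_bind x k

instance (C : Contra S) : AddCommGroup C.A := by
  refine (contraaction_surjective C).addCommGroup _ rfl (fun a b => ?_) (fun a => ?_)
    (fun a b => ?_) (fun a n => ?_) (fun a n => ?_)
  · have := contraaction_bindHom C (point S a + point S b)
    simp only [map_add, bindHom_point, id] at this
    exact this.symm
  · have := contraaction_bindHom C (-point S a)
    simp only [map_neg, bindHom_point, id] at this
    exact this.symm
  · have := contraaction_bindHom C (point S a - point S b)
    simp only [map_sub, bindHom_point, id] at this
    exact this.symm
  · have := contraaction_bindHom C (n • point S a)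
    simp only [map_nsmul, bindHom_point, id] at this
    exact this.symm
  · have := contraaction_bindHom C (n • point S a)
    simp only [map_zsmul, bindHom_point, id] at this
    exact this.symm

lemma contraaction_add (C : Contra S) (a b : FormalSum S C.A) :
    contraaction C (a + b) = contraaction C a + contraaction C b := by
  have := contraaction_bindHom C (point S a + point S b)
  simp only [map_add, bindHom_point, id] at this
  exact this.symm

lemma contraaction_smul (C : Contra S) (s : S) (a : FormalSum S C.A) :
    contraaction C (s • a) = s • contraaction C a := by
  have := contraaction_bindHom C (s • point S a)
  simp only [map_smul, bindHom_point, id] at this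
  exact this.symm

instance (C : Contra S) : Module S C.A :=
  (contraaction_surjective C).module S
    { toFun := contraaction C
      map_zero' := rfl
      map_add' := contraaction_add C } (contraaction_smul C)

/-- The infinite linear combinations of a fixed family of elements. -/
def contraSumHom (C : Contra S) {X : Type u} (c : X → C.A) : FormalSum S X →ₗ[S] C.A where
  toFun a := contraSum C a c
  map_add' a b := by
    rw [contraSum, FormalSum.map, add_bind, contraaction_add]
    rfl
  map_smul' s a := by
    rw [contraSum, FormalSum.map, smul_bind, contraaction_smul]
    rfl

lemma contraSum_smul_left (C : Contra S) {X : Type u} (s : S) (a : FormalSum S X) (c : X → C.A) :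
    contraSum C (s • a) c = s • contraSum C a c :=
  (contraSumHom C c).map_smul s a

lemma contraSum_zero_right (C : Contra S) {X : Type u} (a : FormalSum S X) :
    contraSum C a (fun _ => 0) = 0 :=
  contraaction_map_zero C a

lemma contraSum_smul_right (C : Contra S) {X : Type u} (a : FormalSum S X) (s : X → S)
    (c : X → C.A) : contraSum C a (fun x => s x • c x) =
      contraSum C ⟨fun x => a.coeff x * s x, tendsto_zero_mul_right a.tendsto_zero _⟩ c := by
  change contraSum C a (fun x => contraaction C (s x • point S (c x))) = _
  rw [contraSum_contraaction, contraSum]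
  congr 1
  ext y
  change ∑' x, a.coeff x * (s x * (point S (c x)).coeff y) =
    ∑' x, a.coeff x * s x * (point S (c x)).coeff y
  simp only [mul_assoc]

/-- The sum of a family all of whose coefficients vanish outside of a finite set. -/
lemma contraSum_eq_sum (C : Contra S) {X : Type u} (a : FormalSum S X) (c : X → C.A)
    (F : Finset X) (hF : ∀ x ∉ F, a.coeff x = 0) :
    contraSum C a c = ∑ x ∈ F, a.coeff x • c x := by
  conv_lhs => rw [a.eq_sum_point F hF]
  change contraSumHom C c _ = _
  rw [map_sum]
  refine Finset.sum_congr rfl fun x _ => ?_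
  rw [map_smul]
  exact congrArg _ (contraSum_point C x c)

/-- Homomorphisms of contramodules are linear. -/
def contraLinearMap {B C : Contra S} (f : B ⟶ C) : B.A →ₗ[S] C.A where
  toFun := f.f
  map_add' b c := by
    change f.f (contraaction B _) = contraaction C _
    rw [← hom_contraaction]
    simp only [FormalSum.map, add_bind, point_bind]
  map_smul' s c := by
    change f.f (contraaction B _) = contraaction C _
    rw [← hom_contraaction]
    simp only [FormalSum.map, smul_bind, point_bind]
    rfl

lemma contra_hom_ext {B C : Contra S} {f g : B ⟶ C} (h : ∀ b, f.f b = g.f b) : f = g :=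
  Monad.Algebra.Hom.ext (ConcreteCategory.hom_ext _ _ h)

/-- Constructor for homomorphisms of contramodules. -/
def contraHomMk {B C : Contra S} (f : B.A → C.A)
    (h : ∀ t : FormalSum S B.A, f (contraaction B t) = contraSum C t f) : B ⟶ C where
  f := ↾f
  h := ConcreteCategory.hom_ext _ _ fun t => (h t).symm

lemma contra_mono_of_injective {B C : Contra S} (f : B ⟶ C) (hf : Function.Injective f.f) :
    Mono f :=
  ⟨fun _ _ hgh => contra_hom_ext fun b => hf <|
    congrArg (fun k : _ ⟶ C => k.f b) hgh⟩

lemma contra_surjective_of_isIso {B C : Contra S} (f : B ⟶ C) [IsIso f] :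
    Function.Surjective f.f := fun c =>
  ⟨(inv f).f c, congrArg (fun k : C ⟶ C => k.f c) (IsIso.inv_hom_id f)⟩

/-- The free contramodule. -/
def freeContra (S : Type u) [Ring S] [UniformSpace S] [IsUniformAddGroup S] [IsTopologicalRing S]
    [IsLinearTopology Sᵐᵒᵖ S] [CompleteSpace S] [T2Space S] (X : Type u) : Contra S :=
  (contraMonad S).free.obj X

/-- An element of the free contramodule as a formal sum. -/
def freeContra.toSum {X : Type u} (a : (freeContra S X).A) : FormalSum S X := a

/-- A formal sum as an element of the free contramodule. -/
def freeContra.ofSum {X : Type u} (a : FormalSum S X) : (freeContra S X).A := a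

lemma toSum_contraSum {X Y : Type u} (a : FormalSum S Y) (c : Y → (freeContra S X).A) :
    freeContra.toSum (contraSum (freeContra S X) a c) = a.bind fun y => freeContra.toSum (c y) := by
  have h : (a.map fun y => freeContra.toSum (c y)).join = a.bind fun y => freeContra.toSum (c y) := by
    simp only [FormalSum.map, FormalSum.join, FormalSum.bind_assoc, point_bind]
    rfl
  exact h

/-- The homomorphism from a free contramodule given by the images of the generators. -/
def freeContraDesc {X : Type u} (C : Contra S) (c : X → C.A) : freeContra S X ⟶ C :=
  contraHomMk (fun a => contraSum C (freeContra.toSum a) c) fun t => by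
    rw [← contraSum_id]
    rw [toSum_contraSum, contraSum_bind]
    rfl

lemma freeContraDesc_point {X : Type u} (C : Contra S) (c : X → C.A) (x : X) :
    (freeContraDesc C c).f (freeContra.ofSum (point S x)) = c x :=
  contraSum_point C x c

lemma freeContra.toSum_zero {X : Type u} : freeContra.toSum (0 : (freeContra S X).A) = 0 := by
  ext x
  change ∑' y : FormalSum S X, 0 * y.coeff x = 0
  simp

lemma freeContra_hom_ext {X : Type u} {C : Contra S} {f g : freeContra S X ⟶ C}
    (h : ∀ x, f.f (freeContra.ofSum (point S x)) = g.f (freeContra.ofSum (point S x))) : f = g := by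
  refine contra_hom_ext fun a => ?_
  have : a = contraSum (freeContra S X) (freeContra.toSum a)
      fun x => freeContra.ofSum (point S x) := by
    have := toSum_contraSum (freeContra.toSum a) fun x => freeContra.ofSum (point S x)
    exact ((bind_point (freeContra.toSum a)).symm.trans this.symm)
  rw [this, hom_contraSum, hom_contraSum]
  exact congrArg _ (funext h)

/-- A subset closed under infinite linear combinations as a contramodule. -/
def subContra (C : Contra S) (p : Set C.A)
    (hp : ∀ t : FormalSum S p, contraSum C t Subtype.val ∈ p) : Contra S where
  A := p
  a := ↾fun t : FormalSum S p => (⟨contraSum C t Subtype.val, hp t⟩ : p)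
  unit := ConcreteCategory.hom_ext _ _ fun x => Subtype.ext (contraSum_point C x _)
  assoc :=
    have h : ∀ t : FormalSum S (FormalSum S p), contraSum C t.join Subtype.val =
        contraSum C (t.map fun x => (⟨contraSum C x Subtype.val, hp x⟩ : p)) Subtype.val := by
      intro t
      rw [FormalSum.join, FormalSum.map, contraSum_bind, contraSum_bind]
      simp only [contraSum_point]
      rfl
    ConcreteCategory.hom_ext _ _ fun t => Subtype.ext (h t)

/-- The inclusion of a subcontramodule. -/
def subContraι (C : Contra S) (p : Set C.A)
    (hp : ∀ t : FormalSum S p, contraSum C t Subtype.val ∈ p) : subContra C p hp ⟶ C :=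
  contraHomMk (fun x : p => x.1) fun _ => rfl

lemma subContraι_injective (C : Contra S) (p : Set C.A)
    (hp : ∀ t : FormalSum S p, contraSum C t Subtype.val ∈ p) :
    Function.Injective (subContraι C p hp).f := Subtype.val_injective

/-- Schur's lemma for contramodules. -/
lemma isIso_of_simple_contra {B C : Contra S} [Simple B] [Simple C] (f : B ⟶ C) (hf : f ≠ 0) :
    IsIso f := by
  -- The kernel of `f` is a subcontramodule. A nonzero inclusion would be an isomorphism and force
  -- `f = 0`; so `f` is injective, and a nonzero monomorphism into a simple object is invertible.
  have hp : ∀ t : FormalSum S {b : B.A | f.f b = 0},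
      contraSum B t Subtype.val ∈ {b : B.A | f.f b = 0} := fun t => by
    change f.f _ = 0
    rw [hom_contraSum, funext fun x : {b : B.A | f.f b = 0} => x.2]
    exact contraSum_zero_right C t
  have hmono := contra_mono_of_injective _ (subContraι_injective B _ hp)
  have h0 : subContraι B _ hp = 0 := by
    by_contra hne
    have := isIso_of_mono_of_nonzero hne
    refine hf (contra_hom_ext fun b => ?_)
    obtain ⟨x, rfl⟩ := contra_surjective_of_isIso (subContraι B _ hp) b
    exact x.2
  have hinj : Function.Injective (contraLinearMap f) := by
    rw [injective_iff_map_eq_zero]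
    intro b hb
    exact congrArg (fun k : _ ⟶ B => k.f (⟨b, hb⟩ : {b : B.A | f.f b = 0})) h0
  have := contra_mono_of_injective f hinj
  exact isIso_of_mono_of_nonzero hf

end Contra

/-! ### Semisimple decompositions of the free contramodule with one generator -/

section

variable {S : Type u} [Ring S] [UniformSpace S] [IsUniformAddGroup S] [IsTopologicalRing S]
  [IsLinearTopology Sᵐᵒᵖ S] [CompleteSpace S] [T2Space S]

open FormalSum

/-- The generator of the free contramodule with one generator. -/
def contraGen (S : Type u) [Ring S] [UniformSpace S] [IsUniformAddGroup S] [IsTopologicalRing S]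
    [IsLinearTopology Sᵐᵒᵖ S] [CompleteSpace S] [T2Space S] : (freeContra S PUnit.{u + 1}).A :=
  freeContra.ofSum (point S PUnit.unit)

/-- The element of the ring corresponding to an endomorphism of the free contramodule with one
generator. -/
def endElt (φ : freeContra S PUnit.{u + 1} ⟶ freeContra S PUnit.{u + 1}) : S :=
  (freeContra.toSum (φ.f (contraGen S))).coeff PUnit.unit

lemma endElt_injective : Function.Injective (endElt (S := S)) := fun _ _ h =>
  freeContra_hom_ext fun _ => FormalSum.ext (funext fun _ => h)

/-- Diagrammatic composition matches the multiplication of `S` without reversal: `ψ` is linear, so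
it multiplies the coefficient of the generator on the right. -/
lemma endElt_comp (φ ψ : freeContra S PUnit.{u + 1} ⟶ freeContra S PUnit.{u + 1}) :
    endElt (φ ≫ ψ) = endElt φ * endElt ψ := by
  have h : ψ = freeContraDesc _ fun _ => ψ.f (contraGen S) :=
    freeContra_hom_ext fun x => (freeContraDesc_point _ (fun _ => ψ.f (contraGen S)) x).symm
  have h1 : (φ ≫ ψ).f (contraGen S) =
      contraSum _ (freeContra.toSum (φ.f (contraGen S))) fun _ => ψ.f (contraGen S) :=
    congrArg (fun k : _ ⟶ freeContra S PUnit.{u + 1} => k.f (φ.f (contraGen S))) h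
  rw [endElt, h1, toSum_contraSum, bind_coeff, tsum_eq_single PUnit.unit (by simp)]
  rfl

lemma endElt_id : endElt (𝟙 (freeContra S PUnit.{u + 1})) = 1 := by
  classical
  exact (point_coeff PUnit.unit PUnit.unit).trans (if_pos rfl)

lemma endElt_zero : endElt (0 : freeContra S PUnit.{u + 1} ⟶ freeContra S PUnit.{u + 1}) = 0 :=
  congrArg (fun a : FormalSum S PUnit.{u + 1} => a.coeff PUnit.unit) freeContra.toSum_zero

lemma endElt_surjective : Function.Surjective (endElt (S := S)) := fun a => by
  refine ⟨freeContraDesc _ fun _ => freeContra.ofSum (a • point S PUnit.unit), ?_⟩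
  classical
  rw [endElt, contraGen, freeContraDesc_point]
  change a * (point S PUnit.unit).coeff PUnit.unit = a
  rw [point_coeff, if_pos rfl, mul_one]

open Classical in
/-- The projections of a coproduct onto its summands. -/
def cofanProj {C : Type*} [Category* C] [HasZeroMorphisms C] {J : Type*} {T : J → C} {X : C}
    {i : ∀ j, T j ⟶ X} (hc : IsColimit (Cofan.mk X i)) (j : J) : X ⟶ T j :=
  Cofan.IsColimit.desc hc fun k => if h : k = j then eqToHom (by rw [h]) else 0

open Classical in
lemma cofanProj_self {C : Type*} [Category* C] [HasZeroMorphisms C] {J : Type*} {T : J → C} {X : C}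
    {i : ∀ j, T j ⟶ X} (hc : IsColimit (Cofan.mk X i)) (j : J) :
    i j ≫ cofanProj hc j = 𝟙 (T j) := by
  have := Cofan.IsColimit.fac hc (fun k => if h : k = j then eqToHom (by rw [h]) else 0) j
  simpa using! this

open Classical in
lemma cofanProj_of_ne {C : Type*} [Category* C] [HasZeroMorphisms C] {J : Type*} {T : J → C}
    {X : C} {i : ∀ j, T j ⟶ X} (hc : IsColimit (Cofan.mk X i)) {j k : J} (h : k ≠ j) :
    i k ≫ cofanProj hc j = 0 := by
  have := Cofan.IsColimit.fac hc (fun k => if h : k = j then eqToHom (by rw [h]) else 0) k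
  simpa [h] using! this

/-- Convergence comes from a formal sum. Send the summand `T j` into the `j`-th copy of the
generator inside the free contramodule on `J`; the universal property gives `δ`. The generator goes
to an element of `S[[J]]`, whose coefficients tend to zero by definition. They are the wanted
idempotents, and composing `δ` with the codiagonal shows that they add up to `1`. -/
lemma hasSum_endElt {J : Type u} {T : J → Contra S} {i : ∀ j, T j ⟶ freeContra S PUnit.{u + 1}}
    (hc : IsColimit (Cofan.mk _ i)) :
    HasSum (fun j => endElt (cofanProj hc j ≫ i j)) 1 := by
  classical
  let inc : ∀ j : J, freeContra S PUnit.{u + 1} ⟶ freeContra S J := fun j =>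
    freeContraDesc _ fun _ => freeContra.ofSum (point S j)
  let pr : ∀ j : J, freeContra S J ⟶ freeContra S PUnit.{u + 1} := fun j =>
    freeContraDesc _ fun k => if k = j then contraGen S else 0
  let codiag : freeContra S J ⟶ freeContra S PUnit.{u + 1} := freeContraDesc _ fun _ => contraGen S
  have hinc : ∀ j x, (inc j).f (freeContra.ofSum (point S x)) = freeContra.ofSum (point S j) :=
    fun j x => freeContraDesc_point _ _ x
  have hincpr : ∀ j, inc j ≫ pr j = 𝟙 _ := fun j => freeContra_hom_ext fun x => by
    change (pr j).f ((inc j).f _) = _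
    rw [hinc, freeContraDesc_point, if_pos rfl]
    rfl
  have hincpr' : ∀ j k, k ≠ j → inc k ≫ pr j = 0 := fun j k h => freeContra_hom_ext fun x => by
    change (pr j).f ((inc k).f _) = _
    rw [hinc, freeContraDesc_point, if_neg h]
    rfl
  have hcodiag : ∀ j, inc j ≫ codiag = 𝟙 _ := fun j => freeContra_hom_ext fun x => by
    change codiag.f ((inc j).f _) = _
    rw [hinc, freeContraDesc_point]
    rfl
  let δ : freeContra S PUnit.{u + 1} ⟶ freeContra S J := Cofan.IsColimit.desc hc fun j => i j ≫ inc j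
  have hδ : ∀ j, i j ≫ δ = i j ≫ inc j := fun j => Cofan.IsColimit.fac hc _ j
  have hδpr : ∀ j, δ ≫ pr j = cofanProj hc j ≫ i j := fun j =>
    Cofan.IsColimit.hom_ext hc _ _ fun k => by
      change i k ≫ δ ≫ pr j = i k ≫ cofanProj hc j ≫ i j
      rw [reassoc_of% hδ]
      by_cases h : k = j
      · subst h
        rw [hincpr, reassoc_of% cofanProj_self hc, Category.comp_id]
      · rw [hincpr' j k h, reassoc_of% cofanProj_of_ne hc h, zero_comp, comp_zero]
  have hδcodiag : δ ≫ codiag = 𝟙 _ := Cofan.IsColimit.hom_ext hc _ _ fun k => by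
    change i k ≫ δ ≫ codiag = i k ≫ 𝟙 _
    rw [reassoc_of% hδ, hcodiag]
  let a : FormalSum S J := freeContra.toSum (δ.f (contraGen S))
  have ha : ∀ j, a.coeff j = endElt (cofanProj hc j ≫ i j) := fun j => by
    rw [← hδpr]
    change _ = (freeContra.toSum (contraSum _ a _)).coeff PUnit.unit
    rw [toSum_contraSum, bind_coeff, tsum_eq_single j]
    · rw [if_pos rfl]
      change _ = _ * (point S PUnit.unit).coeff PUnit.unit
      rw [point_coeff, if_pos rfl, mul_one]
    · intro k hk
      rw [if_neg hk, freeContra.toSum_zero, zero_coeff, mul_zero]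
  have hsum : ∑' j, a.coeff j = 1 := by
    rw [← endElt_id, ← hδcodiag]
    change _ = (freeContra.toSum (contraSum _ a _)).coeff PUnit.unit
    rw [toSum_contraSum, bind_coeff]
    refine tsum_congr fun j => ?_
    change _ = _ * (point S PUnit.unit).coeff PUnit.unit
    rw [point_coeff, if_pos rfl, mul_one]
  have := (summable_of_tendsto a.tendsto_zero).hasSum
  rw [hsum] at this
  exact this.congr_fun fun j => (ha j).symm

lemma isSimpleDecomposition_endElt {J : Type u} {T : J → Contra S}
    {i : ∀ j, T j ⟶ freeContra S PUnit.{u + 1}} (hc : IsColimit (Cofan.mk _ i))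
    (hT : ∀ j, Simple (T j)) :
    IsSimpleDecomposition fun j => endElt (cofanProj hc j ≫ i j) := by
  refine ⟨fun j => ?_, fun j k hjk => ?_, hasSum_endElt hc, fun j hj => ?_, fun j a ha => ?_⟩
  · rw [← endElt_comp, Category.assoc, reassoc_of% cofanProj_self hc]
  · rw [← endElt_comp, Category.assoc, reassoc_of% cofanProj_of_ne hc hjk, zero_comp, comp_zero,
      endElt_zero]
  · have h : cofanProj hc j ≫ i j = 0 := endElt_injective (hj.trans endElt_zero.symm)
    apply id_nonzero (T j)
    rw [← cofanProj_self hc j, ← Category.comp_id (cofanProj hc j), ← cofanProj_self hc j,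
      reassoc_of% h, zero_comp, comp_zero]
  · obtain ⟨α, rfl⟩ := endElt_surjective a
    set g : T j ⟶ freeContra S PUnit.{u + 1} := i j ≫ α with hg
    have hja : endElt (cofanProj hc j ≫ i j) * endElt α = endElt (cofanProj hc j ≫ g) := by
      rw [← endElt_comp, Category.assoc]
    simp only [hja] at ha ⊢
    -- If all components of `g` vanished, multiplying the sum `1` of the idempotents by the element
    -- of `g` would give zero. A nonzero component is invertible by Schur's lemma, which yields the
    -- right factor.
    obtain ⟨k, hk⟩ : ∃ k, g ≫ cofanProj hc k ≠ 0 := by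
      by_contra! hall
      have h0 : ∀ k, endElt (cofanProj hc j ≫ g) * endElt (cofanProj hc k ≫ i k) = 0 := fun k => by
        rw [← endElt_comp, Category.assoc, reassoc_of% hall k, zero_comp, comp_zero, endElt_zero]
      have h1 := (hasSum_endElt hc).mul_left (endElt (cofanProj hc j ≫ g))
      simp only [h0, mul_one] at h1
      exact ha (h1.unique hasSum_zero)
    have := isIso_of_simple_contra _ hk
    refine ⟨endElt (cofanProj hc k ≫ inv (g ≫ cofanProj hc k) ≫ i j), ?_⟩
    rw [← endElt_comp]
    congr 1
    have h : g ≫ cofanProj hc k ≫ inv (g ≫ cofanProj hc k) = 𝟙 _ := by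
      rw [← Category.assoc, IsIso.hom_inv_id]
    rw [Category.assoc, reassoc_of% h]

lemma IsSemisimpleCategory.exists_isSimpleDecomposition
    (h : IsSemisimpleCategory (Contra S)) : ∃ (ι : Type u) (e : ι → S), IsSimpleDecomposition e := by
  obtain ⟨J, T, i, hT, ⟨hc⟩⟩ := h (freeContra S PUnit.{u + 1})
  exact ⟨J, _, isSimpleDecomposition_endElt hc hT⟩

end

/-! ### Contramodules over a ring with a simple decomposition -/

section

variable {S : Type u} [Ring S] [UniformSpace S] [IsUniformAddGroup S] [IsTopologicalRing S]
  [IsLinearTopology Sᵐᵒᵖ S] [CompleteSpace S] [T2Space S]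

open FormalSum

lemma contraSum_const (C : Contra S) {X : Type u} (a : FormalSum S X) (c : C.A) :
    contraSum C a (fun _ => c) = (∑' x, a.coeff x) • c := by
  change contraaction C _ = contraaction C _
  congr 1
  ext y
  change ∑' x, a.coeff x * (point S c).coeff y = (∑' x, a.coeff x) * (point S c).coeff y
  exact (summable_of_tendsto a.tendsto_zero).tsum_mul_right _

lemma freeContra.toSum_add {X : Type u} (a b : (freeContra S X).A) :
    freeContra.toSum (a + b) = freeContra.toSum a + freeContra.toSum b := by
  have h : (point S (freeContra.toSum a) + point S (freeContra.toSum b)).join =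
      freeContra.toSum a + freeContra.toSum b := by
    rw [FormalSum.join, add_bind, point_bind, point_bind]
    rfl
  exact h

lemma freeContra.toSum_smul {X : Type u} (s : S) (a : (freeContra S X).A) :
    freeContra.toSum (s • a) = s • freeContra.toSum a := by
  have h : (s • point S (freeContra.toSum a)).join = s • freeContra.toSum a := by
    rw [FormalSum.join, smul_bind, point_bind]
    rfl
  exact h

/-- The identification of the free contramodule with the module of formal sums. -/
def freeContra.toSumHom (X : Type u) : (freeContra S X).A →ₗ[S] FormalSum S X where
  toFun := freeContra.toSum
  map_add' := freeContra.toSum_add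
  map_smul' := freeContra.toSum_smul

variable {ι : Type u} {e : ι → S} (he : IsSimpleDecomposition e)

namespace IsSimpleDecomposition

include he

lemma tendsto_zero : Tendsto e cofinite (𝓝 0) := he.hasSum.summable.tendsto_cofinite_zero

/-- An open right ideal avoiding `e i` meets the simple right ideal `e i S` only in zero; so `e i S`
is discrete. -/
lemma isOpen_mul_eq_zero (i : ι) : IsOpen {a : S | e i * a = 0} := by
  have h : {e i}ᶜ ∈ 𝓝 (0 : S) := isOpen_compl_singleton.mem_nhds (he.ne_zero i).symm
  obtain ⟨J, hJ, hJe⟩ := (IsLinearTopology.hasBasis_open_submodule Sᵐᵒᵖ).mem_iff.1 h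
  have : {a : S | e i * a = 0} = (fun a => e i * a) ⁻¹' J := by
    ext a
    refine ⟨fun ha => ?_, fun ha => ?_⟩
    · change e i * a ∈ J
      rw [show e i * a = 0 from ha]
      exact zero_mem _
    · by_contra hne
      obtain ⟨b, hb⟩ := he.exists_mul i a hne
      have : e i ∈ J := hb ▸ mul_mem_right J ha b
      exact hJe this rfl
  rw [this]
  exact hJ.preimage (continuous_const.mul continuous_id)

lemma finite_mul_ne_zero (i : ι) {X : Type*} {a : X → S} (ha : Tendsto a cofinite (𝓝 0)) :
    {x | e i * a x ≠ 0}.Finite :=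
  ha ((he.isOpen_mul_eq_zero i).mem_nhds (mul_zero _))

lemma finite_mul_mul_ne_zero (i : ι) (s : S) : {j | e i * s * e j ≠ 0}.Finite := by
  have := he.finite_mul_ne_zero i (a := fun j => s * e j) (by
    simpa using he.tendsto_zero.const_mul s)
  simpa only [mul_assoc] using this

lemma eq_zero_of_mul_eq_zero {a : S} (h : ∀ i, e i * a = 0) : a = 0 := by
  have := he.hasSum.mul_right a
  simp only [h, one_mul] at this
  exact this.unique hasSum_zero

/-- Passage from simple right ideals to left inverses. With `x = e j a e i` and `y = e i b e j`
satisfying `x y = e j`, the product `y x` is a nonzero idempotent in `e i S`; since `e i` is a right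
multiple of it, the two coincide. -/
lemma exists_mul_left {i j : ι} {a : S} (h : e j * a * e i ≠ 0) :
    ∃ t, e i * t * e j * (e j * a * e i) = e i := by
  obtain ⟨b, hb⟩ := he.exists_mul j (a * e i) (by rwa [← mul_assoc])
  set x := e j * a * e i with hx
  set y := e i * b * e j with hy
  have hb' : x * b = e j := by simpa only [hx, mul_assoc] using hb
  have hxi : x * e i = x := by rw [hx, mul_assoc, he.idem]
  have hjx : e j * x = x := by rw [hx, ← mul_assoc, ← mul_assoc, he.idem]
  have hxy : x * y = e j := by
    rw [hy, ← mul_assoc, ← mul_assoc, hxi, hb', he.idem]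
  have hyx : e i * (y * x) ≠ 0 := fun h0 => h <| by
    have : e i * (y * x) = y * x := by rw [hy]; simp only [← mul_assoc, he.idem]
    rw [this] at h0
    calc x = x * y * x := by rw [hxy, hjx]
      _ = 0 := by rw [mul_assoc, h0, mul_zero]
  have hiy : e i * (y * x) = y * x := by rw [hy]; simp only [← mul_assoc, he.idem]
  obtain ⟨c, hc⟩ := he.exists_mul i _ hyx
  rw [hiy] at hc
  refine ⟨b, ?_⟩
  change y * x = e i
  calc y * x = y * x * e i := by rw [mul_assoc y x, hxi]
    _ = y * x * (y * x * c) := by rw [hc]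
    _ = y * (x * y) * x * c := by simp only [mul_assoc]
    _ = y * x * c := by
      rw [hxy, mul_assoc y, hjx]
    _ = e i := hc

end IsSimpleDecomposition

/-! ### The ring generated by the corners and its locally unital modules -/

variable (e) in
/-- The subring generated by the corners `eᵢ S eⱼ`. -/
def cornerRing : Subring S := Subring.closure {x | ∃ i s j, x = e i * s * e j}

/-- The elements of a corner `eᵢ S eⱼ`. -/
def corner (e : ι → S) (i : ι) (s : S) (j : ι) : cornerRing e :=
  ⟨e i * s * e j, Subring.subset_closure ⟨i, s, j, rfl⟩⟩

lemma corner_val (i : ι) (s : S) (j : ι) : (corner e i s j : S) = e i * s * e j := rfl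

/-- The idempotents of the decomposition as elements of the subring generated by corners. -/
def cornerIdem (e : ι → S) (i : ι) : cornerRing e := corner e i 1 i

include he in
lemma cornerIdem_val (i : ι) : (cornerIdem e i : S) = e i := by
  rw [cornerIdem, corner_val, mul_one, he.idem]

-- Discreteness of `e i S` leaves only finitely many nonzero terms in `e i s = ∑ e i s e j`.
include he in
lemma IsSimpleDecomposition.mul_mem_cornerRing (i : ι) (s : S) : e i * s ∈ cornerRing e := by
  have h := he.hasSum.mul_left (e i * s)
  have hfin := he.finite_mul_mul_ne_zero i s
  rw [mul_one] at h
  have h' := hasSum_sum_of_ne_finset_zero (L := .unconditional ι) (f := fun j => e i * s * e j) (s := hfin.toFinset)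
    (by intro j hj; simpa using hj)
  rw [h.unique h']
  exact sum_mem fun j _ => (corner e i s j).2

include he in
lemma IsSimpleDecomposition.mem_cornerRing {s : S} (hs : {i | e i * s ≠ 0}.Finite) :
    s ∈ cornerRing e := by
  have h := he.hasSum.mul_right s
  rw [one_mul] at h
  have h' := hasSum_sum_of_ne_finset_zero (L := .unconditional ι) (f := fun i => e i * s) (s := hs.toFinset)
    (by intro j hj; simpa using hj)
  rw [h.unique h']
  exact sum_mem fun j _ => he.mul_mem_cornerRing j s

/-- The filter of left ideals defining locally unital modules over the subring generated by
corners. -/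
def cornerFilter : Order.PFilter (Ideal (cornerRing e)) :=
  Order.IsPFilter.toPFilter (F := {I | ∃ s : Finset ι, 1 - ∑ i ∈ s, cornerIdem e i ∈ I})
    (Order.IsPFilter.of_def ⟨⊤, ∅, trivial⟩
      (by
        classical
        rintro I ⟨s, hs⟩ J ⟨t, ht⟩
        -- The complement of a larger partial sum is a left multiple of that of a smaller one; so
        -- both ideals contain the complement for the union.
        have key : ∀ s' t' : Finset ι, s' ⊆ t' → 1 - ∑ i ∈ t', cornerIdem e i =
            (1 - ∑ i ∈ t', cornerIdem e i) * (1 - ∑ i ∈ s', cornerIdem e i) := by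
          intro s' t' h
          have : (∑ i ∈ t', cornerIdem e i) * ∑ i ∈ s', cornerIdem e i =
              ∑ i ∈ s', cornerIdem e i := by
            rw [Finset.mul_sum]
            refine Finset.sum_congr rfl fun i hi => ?_
            rw [Finset.sum_mul, Finset.sum_eq_single_of_mem i (h hi)]
            · refine Subtype.ext ?_
              rw [Subring.coe_mul, cornerIdem_val he, he.idem]
            · intro j _ hj
              refine Subtype.ext ?_
              rw [Subring.coe_mul, cornerIdem_val he, cornerIdem_val he, he.orth j i hj]
              rfl
          rw [mul_sub, mul_one, sub_mul, one_mul, this, sub_self, sub_zero]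
        refine ⟨I ⊓ J, ⟨s ∪ t, ?_, ?_⟩, inf_le_left, inf_le_right⟩
        · rw [key s _ Finset.subset_union_left]
          exact I.mul_mem_left _ hs
        · rw [key t _ Finset.subset_union_right]
          exact J.mul_mem_left _ ht)
      (fun {I J} hIJ ⟨s, hs⟩ => ⟨s, hIJ hs⟩))

lemma cornerFilter_torsion {N : Type u} [AddCommGroup N] [Module (cornerRing e) N]
    (hN : torsionClass (cornerFilter he) (ModuleCat.of _ N)) (n : N) :
    ∃ s : Finset ι, n = ∑ i ∈ s, cornerIdem e i • n := by
  obtain ⟨s, hs⟩ := hN n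
  refine ⟨s, ?_⟩
  have hs' : (1 - ∑ i ∈ s, cornerIdem e i) • n = 0 := hs
  rwa [sub_smul, one_smul, sub_eq_zero, Finset.sum_smul] at hs'

/-- A vector is a finite sum of its components, and a nonzero multiple of a component is carried
back to it by an element of a corner, thanks to `exists_mul_left`. -/
lemma isSemisimpleModule_of_cornerFilter {N : Type u} [AddCommGroup N] [Module (cornerRing e) N]
    (hN : torsionClass (cornerFilter he) (ModuleCat.of _ N)) :
    IsSemisimpleModule (cornerRing e) N := by
  refine isSemisimpleModule_of_isSemisimpleModule_submodule'
    (p := fun p : ι × N => Submodule.span (cornerRing e) {cornerIdem e p.1 • p.2}) ?_ ?_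
  · rintro ⟨i, n⟩
    refine isSemisimpleModule_span_singleton fun r hr => ?_
    rw [smul_smul] at hr
    have hri : (r : S) * e i ≠ 0 := fun h => hr (by
      have : r * cornerIdem e i = 0 := Subtype.ext (by
        rw [Subring.coe_mul, cornerIdem_val he, h]; rfl)
      rw [this, zero_smul])
    obtain ⟨j, hj⟩ : ∃ j, e j * ((r : S) * e i) ≠ 0 := by
      by_contra! h
      exact hri (he.eq_zero_of_mul_eq_zero h)
    rw [← mul_assoc] at hj
    obtain ⟨t, ht⟩ := he.exists_mul_left hj
    refine ⟨corner e i t j, ?_⟩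
    rw [smul_smul, smul_smul]
    congr 1
    refine Subtype.ext ?_
    rw [Subring.coe_mul, Subring.coe_mul, cornerIdem_val he, corner_val]
    conv_rhs => rw [← ht]
    simp only [mul_assoc]
    rw [← mul_assoc (e j) (e j), he.idem]
  · rw [eq_top_iff]
    intro n _
    obtain ⟨s, hs⟩ := cornerFilter_torsion he hN n
    rw [hs]
    exact sum_mem fun i _ => Submodule.mem_iSup_of_mem (i, n) (Submodule.mem_span_singleton_self _)

/-! ### The locally unital part of a contramodule -/

/-- The idempotents of a simple decomposition as a formal sum. -/
def idemSum : FormalSum S ι := ⟨e, he.tendsto_zero⟩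

/-- Since `e i * e i = e i`, an element is recovered from its components by infinite summation. -/
lemma contraSum_idemSum_smul (C : Contra S) (c : C.A) :
    contraSum C (idemSum he) (fun i => e i • c) = c := by
  rw [contraSum_smul_right, contraSum_const]
  change (∑' i, e i * e i) • c = c
  simp only [he.idem, he.hasSum.tsum_eq, one_smul]

include he in
lemma contra_ext_of_idem (C : Contra S) {c d : C.A} (h : ∀ i, e i • c = e i • d) : c = d := by
  rw [← contraSum_idemSum_smul he C c, ← contraSum_idemSum_smul he C d]
  exact congrArg _ (funext h)

/-- For fixed `i` and `s`, only finitely many summands of `eᵢ s ∑ⱼ eⱼ cⱼ` are nonzero. -/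
lemma smul_smul_contraSum_idemSum (C : Contra S) (c : ι → C.A) (i : ι) (s : S) :
    (e i * s) • contraSum C (idemSum he) c =
      ∑ j ∈ (he.finite_mul_mul_ne_zero i s).toFinset, (e i * s * e j) • c j := by
  rw [← contraSum_smul_left, contraSum_eq_sum C _ c]
  · rfl
  · intro j hj
    simpa using! hj

/-- One component of an infinite combination is finite, since `e i` kills almost all coefficients.
Linear maps can therefore be compared with the contraaction componentwise. -/
lemma smul_contraaction (C : Contra S) (t : FormalSum S C.A) {X : Contra S} (f : C.A → X.A)
    (i : ι) : e i • contraSum X t f =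
      ∑ c ∈ (he.finite_mul_ne_zero i t.tendsto_zero).toFinset, (e i * t.coeff c) • f c := by
  rw [← contraSum_smul_left, contraSum_eq_sum X _ f]
  · rfl
  · intro j hj
    simpa using! hj

/-- The elements of a contramodule having finitely many nonzero components. -/
def finitePart (C : Contra S) : Submodule (cornerRing e) C.A where
  carrier := {c | {i | e i • c ≠ 0}.Finite}
  zero_mem' := by simp
  add_mem' {c d} hc hd := by
    refine (hc.union hd).subset fun i hi => ?_
    by_contra h
    simp only [Set.mem_union, Set.mem_ofPred_eq, not_or, not_not] at h
    exact hi (by rw [smul_add, h.1, h.2, add_zero])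
  smul_mem' := by
    rintro ⟨r, hr⟩ c hc
    change {i | e i • r • c ≠ 0}.Finite
    change {i | e i • c ≠ 0}.Finite at hc
    induction hr using Subring.closure_induction generalizing c with
    | mem x hx =>
      obtain ⟨j, s, k, rfl⟩ := hx
      refine (Set.finite_singleton j).subset fun i hi => ?_
      by_contra hij
      refine hi ?_
      rw [smul_smul, ← mul_assoc, ← mul_assoc, he.orth i j hij]
      simp
    | zero => simp
    | one => simpa using hc
    | add x y _ _ hx hy =>
      refine ((hx hc).union (hy hc)).subset fun i hi => ?_
      by_contra h
      simp only [Set.mem_union, Set.mem_ofPred_eq, not_or, not_not] at h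
      exact hi (by rw [add_smul, smul_add, h.1, h.2, add_zero])
    | neg x _ hx => simpa using hx hc
    | mul x y _ _ hx hy =>
      simp only [mul_smul]
      exact hx (hy hc)

lemma mem_finitePart {C : Contra S} {c : C.A} :
    c ∈ finitePart he C ↔ {i | e i • c ≠ 0}.Finite := Iff.rfl

lemma idem_smul_mem_finitePart (C : Contra S) (i : ι) (s : S) (c : C.A) :
    (e i * s) • c ∈ finitePart he C := by
  refine (Set.finite_singleton i).subset fun j hj => ?_
  by_contra hij
  refine hj ?_
  rw [smul_smul, ← mul_assoc, he.orth j i hij]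
  simp

lemma idem_smul_mem_finitePart' (C : Contra S) (i : ι) (c : C.A) :
    e i • c ∈ finitePart he C := by
  simpa using idem_smul_mem_finitePart he C i 1 c

lemma exists_eq_sum_of_mem_finitePart {C : Contra S} {c : C.A} (hc : c ∈ finitePart he C) :
    ∃ F : Finset ι, c = ∑ i ∈ F, e i • c := by
  have hc' := (mem_finitePart he).1 hc
  refine ⟨hc'.toFinset, contra_ext_of_idem he C fun j => ?_⟩
  rw [Finset.smul_sum]
  by_cases hj : j ∈ hc'.toFinset
  · rw [Finset.sum_eq_single_of_mem j hj, smul_smul, he.idem]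
    intro i _ hij
    rw [smul_smul, he.orth j i hij.symm, zero_smul]
  · rw [Finset.sum_eq_zero]
    · simpa using hj
    · intro i hi
      rw [smul_smul, he.orth j i (by rintro rfl; exact hj hi), zero_smul]

lemma torsionClass_finitePart (C : Contra S) :
    torsionClass (cornerFilter he) (ModuleCat.of _ (finitePart he C)) := by
  have key : ∀ c : finitePart he C, ∃ F : Finset ι, (1 - ∑ i ∈ F, cornerIdem e i) • c = 0 := by
    intro c
    obtain ⟨F, hF⟩ := exists_eq_sum_of_mem_finitePart he c.2
    refine ⟨F, ?_⟩
    refine Subtype.ext ?_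
    change ((1 - ∑ i ∈ F, cornerIdem e i : cornerRing e) : S) • c.1 = 0
    rw [AddSubgroupClass.coe_sub, Subring.coe_one, AddSubmonoidClass.coe_finsetSum]
    simp only [cornerIdem_val he]
    rw [sub_smul, one_smul, sub_eq_zero, Finset.sum_smul]
    exact hF
  exact fun c => key c

/-- The locally unital part of a contramodule as a functor. -/
def finitePartFunctor : Contra S ⥤ (torsionClass (cornerFilter he)).FullSubcategory where
  obj C := ⟨ModuleCat.of _ (finitePart he C), torsionClass_finitePart he C⟩
  map {B C} f := ObjectProperty.homMk (ModuleCat.ofHom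
    ((contraLinearMap f).restrictScalars (cornerRing e) |>.restrict (p := finitePart he B)
      (q := finitePart he C) fun b hb => Set.Finite.subset hb fun i hi hb => hi (by
        change e i • contraLinearMap f b = 0
        rw [← map_smul, hb, map_zero])))
  map_id C := rfl
  map_comp f g := rfl

/-! ### The equivalence of contramodules with locally unital modules -/

instance : (finitePartFunctor he).Faithful where
  map_injective {B C f g} h := contra_hom_ext fun b => by
    refine contra_ext_of_idem he C fun i => ?_
    change e i • contraLinearMap f b = e i • contraLinearMap g b
    rw [← map_smul, ← map_smul]
    exact congrArg (fun k : (finitePartFunctor he).obj B ⟶ (finitePartFunctor he).obj C =>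
      (k.hom.hom ⟨e i • b, idem_smul_mem_finitePart' he B i b⟩ : finitePart he C).1) h

section

variable {B C : Contra S} (φ : finitePart he B →ₗ[cornerRing e] finitePart he C)

/-- The component `eᵢ b` of an element of a contramodule. -/
def idemPart (B : Contra S) (i : ι) (b : B.A) : finitePart he B :=
  ⟨e i • b, idem_smul_mem_finitePart' he B i b⟩

/-- The extension of a homomorphism of locally unital parts to contramodules. -/
def extendFun (b : B.A) : C.A := contraSum C (idemSum he) fun i => (φ (idemPart he B i b)).1

/-- Both sides expand into the same finite sum over `j`, with coefficients in the corners `e i S e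
j`, over which `φ` is linear. -/
lemma smul_extendFun (i : ι) (s : S) (b : B.A) (b' : finitePart he B)
    (hb : b'.1 = (e i * s) • b) : (e i * s) • extendFun he φ b = (φ b').1 := by
  rw [extendFun, smul_smul_contraSum_idemSum]
  have h := smul_smul_contraSum_idemSum he B (fun j => e j • b) i s
  rw [contraSum_idemSum_smul] at h
  have h' : b' =
      ∑ j ∈ (he.finite_mul_mul_ne_zero i s).toFinset, corner e i s j • idemPart he B j b := by
    refine Subtype.ext ?_
    rw [AddSubmonoidClass.coe_finsetSum, hb]
    exact h
  rw [h', map_sum, AddSubmonoidClass.coe_finsetSum]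
  refine Finset.sum_congr rfl fun j _ => ?_
  rw [map_smul]
  rfl

lemma idem_smul_extendFun (i : ι) (b : B.A) (b' : finitePart he B) (hb : b'.1 = e i • b) :
    e i • extendFun he φ b = (φ b').1 := by
  have := smul_extendFun he φ i 1 b b' (by rw [mul_one, hb])
  rwa [mul_one] at this

/-- The extension of a homomorphism of locally unital parts to a homomorphism of contramodules. -/
def extendHom : B ⟶ C :=
  contraHomMk (extendFun he φ) fun t => by
    refine contra_ext_of_idem he C fun i => ?_
    rw [smul_contraaction he B t, ← contraSum_id, idem_smul_extendFun he φ i _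
      (∑ c ∈ (he.finite_mul_ne_zero i t.tendsto_zero).toFinset,
        ⟨(e i * t.coeff c) • c, idem_smul_mem_finitePart he B i _ c⟩) (by
      rw [AddSubmonoidClass.coe_finsetSum]
      exact (smul_contraaction he B t id i).symm)]
    rw [map_sum, AddSubmonoidClass.coe_finsetSum]
    exact Finset.sum_congr rfl fun c _ => (smul_extendFun he φ i _ c _ rfl).symm

lemma extendHom_apply (b : finitePart he B) : (extendHom he φ).f b.1 = (φ b).1 := by
  refine contra_ext_of_idem he C fun i => ?_
  refine (idem_smul_extendFun he φ i b.1 (cornerIdem e i • b) ?_).trans ?_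
  · change (cornerIdem e i : S) • b.1 = _
    rw [cornerIdem_val he]
  · rw [map_smul]
    change (cornerIdem e i : S) • (φ b).1 = _
    rw [cornerIdem_val he]

end

instance : (finitePartFunctor he).Full where
  map_surjective {B C} φ :=
    ⟨extendHom he φ.hom.hom, by
      ext b
      exact Subtype.ext (extendHom_apply he φ.hom.hom b)⟩

section

variable (N : Type u) [AddCommGroup N] [Module (cornerRing e) N]

/-- The coefficients of an element of the locally unital part of a free contramodule. -/
def finiteCoeff : finitePart he (freeContra S N) →ₗ[cornerRing e] N →₀ cornerRing e where
  toFun a := Finsupp.ofSupportFinite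
    (fun n => ⟨(freeContra.toSum a.1).coeff n, he.mem_cornerRing (by
      refine Set.Finite.subset ((mem_finitePart he).1 a.2) fun i hi h => hi ?_
      have := congrArg (fun a => a.coeff n) (freeContra.toSum_smul (e i) a.1)
      rw [h, freeContra.toSum_zero] at this
      exact this.symm)⟩)
    (by
      obtain ⟨F, hF⟩ := exists_eq_sum_of_mem_finitePart he a.2
      refine Set.Finite.subset (Set.Finite.biUnion F.finite_toSet fun i _ =>
        he.finite_mul_ne_zero i (freeContra.toSum a.1).tendsto_zero) fun n hn => ?_
      by_contra h
      simp only [Set.mem_iUnion, not_exists, Set.mem_ofPred_eq, not_not] at h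
      refine hn (Subtype.ext ?_)
      have hsum := congrArg (freeContra.toSumHom N) hF
      rw [map_sum] at hsum
      have hn' := congrArg (fun a => a.coeff n) hsum
      simp only [sum_coeff, map_smul, smul_coeff] at hn'
      exact hn'.trans (Finset.sum_eq_zero fun i hi => h i hi))
  map_add' a b := Finsupp.ext fun n => Subtype.ext
    (congrArg (fun a => a.coeff n) (freeContra.toSum_add a.1 b.1))
  map_smul' r a := Finsupp.ext fun n => Subtype.ext
    (congrArg (fun a => a.coeff n) (freeContra.toSum_smul (r : S) a.1))

/-- The evaluation map from the locally unital part of the free contramodule on a module. -/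
def finiteEval : finitePart he (freeContra S N) →ₗ[cornerRing e] N :=
  Finsupp.linearCombination (cornerRing e) id ∘ₗ finiteCoeff he N

/-- A vector `n` is a finite sum of vectors `e i • n`, and each of these is the value at `e i` times
the generator `n`. -/
lemma finiteEval_surjective (hN : torsionClass (cornerFilter he) (ModuleCat.of _ N)) :
    Function.Surjective (finiteEval he N) := by
  intro n
  obtain ⟨F, hF⟩ := cornerFilter_torsion he hN n
  have h : ∀ i, finiteEval he N (idemPart he _ i (freeContra.ofSum (point S n))) =
      cornerIdem e i • n := fun i => by
    classical
    have : finiteCoeff he N (idemPart he _ i (freeContra.ofSum (point S n))) =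
        Finsupp.single n (cornerIdem e i) := by
      refine Finsupp.ext fun m => Subtype.ext ?_
      refine (congrArg (fun a => a.coeff m)
        (freeContra.toSum_smul (e i) (freeContra.ofSum (point S n)))).trans ?_
      change e i * (point S n).coeff m = _
      rw [point_coeff, Finsupp.single_apply]
      by_cases hm : m = n
      · rw [if_pos hm, if_pos hm.symm, mul_one, cornerIdem_val he]
      · rw [if_neg hm, if_neg (Ne.symm hm), mul_zero]
        rfl
    rw [finiteEval, LinearMap.comp_apply, this, Finsupp.linearCombination_single]
    rfl
  refine ⟨∑ i ∈ F, idemPart he _ i (freeContra.ofSum (point S n)), ?_⟩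
  rw [map_sum]
  exact (Finset.sum_congr rfl fun i _ => h i).trans hF.symm

end

/-- Semisimplicity splits the evaluation map `Ψ` from a free contramodule by some `σ`. The
idempotent `σ ∘ Ψ` extends to the contramodule, and the locally unital part of its fixed points is
isomorphic to the given module. -/
instance : (finitePartFunctor he).EssSurj where
  mem_essImage N := by
    let R := cornerRing e
    let Ψ := finiteEval he N.obj
    have hss := isSemisimpleModule_of_cornerFilter he (torsionClass_finitePart he (freeContra S N.obj))
    have := isSemisimpleModule_of_cornerFilter he N.property
    obtain ⟨σ, hσ⟩ := IsSemisimpleModule.lifting_property Ψ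
      (finiteEval_surjective he N.obj N.property) LinearMap.id
    let p : freeContra S N.obj ⟶ freeContra S N.obj := extendHom he (σ ∘ₗ Ψ)
    have hp : ∀ t : FormalSum S {a | p.f a = a}, contraSum _ t Subtype.val ∈ {a | p.f a = a} :=
      fun t => by
        change p.f _ = _
        rw [hom_contraSum, funext fun x : {a | p.f a = a} => x.2]
    let C := subContra _ _ hp
    let j : finitePart he C →ₗ[R] finitePart he (freeContra S N.obj) :=
      ((finitePartFunctor he).map (subContraι _ _ hp)).hom.hom
    have hjinj : Function.Injective j := fun a b h => Subtype.ext <|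
      subContraι_injective _ _ hp (a₁ := a.1) (a₂ := b.1)
        (congrArg (fun x : finitePart he (freeContra S N.obj) => x.1) h)
    have hj : ∀ c, σ (Ψ (j c)) = j c := fun c => Subtype.ext <|
      (extendHom_apply he (σ ∘ₗ Ψ) (j c)).symm.trans c.1.2
    have hbij : Function.Bijective (Ψ ∘ₗ j) := by
      constructor
      · intro a b h
        apply hjinj
        rw [← hj a, ← hj b]
        exact congrArg σ h
      -- The section `σ n` is fixed by `p`, so it is the preimage once its components are seen to be
      -- finite in number inside the subcontramodule.
      · intro n
        have hσn : p.f (σ n).1 = (σ n).1 := by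
          refine (extendHom_apply he (σ ∘ₗ Ψ) (σ n)).trans ?_
          exact congrArg (fun x => (σ x).1) (LinearMap.congr_fun hσ n)
        let c : C.A := (⟨(σ n).1, hσn⟩ : {a | p.f a = a})
        have hc : c ∈ finitePart he C := by
          refine Set.Finite.subset ((mem_finitePart he).1 (σ n).2) fun i hi h => hi ?_
          apply subContraι_injective _ _ hp
          have h1 := (contraLinearMap (subContraι _ _ hp)).map_smul (e i) c
          have h2 := (contraLinearMap (subContraι _ _ hp)).map_zero
          exact h1.trans (h.trans h2.symm)
        refine ⟨⟨c, hc⟩, ?_⟩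
        exact LinearMap.congr_fun hσ n
    exact ⟨C, ⟨(torsionClass (cornerFilter he)).isoMk
      (LinearEquiv.ofBijective (Ψ ∘ₗ j) hbij).toModuleIso⟩⟩

instance : (finitePartFunctor he).IsEquivalence where

/-! ### Transport along equivalences -/

lemma IsSemisimpleCategory.of_isEquivalence {C D : Type*} [Category.{u} C] [Category.{u} D]
    [HasZeroMorphisms C] [HasZeroMorphisms D] (F : C ⥤ D) [F.IsEquivalence]
    (h : IsSemisimpleCategory D) : IsSemisimpleCategory C := by
  intro X
  obtain ⟨J, T, i, hT, ⟨hc⟩⟩ := h (F.obj X)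
  have hi : ∀ j, F.map (F.preimage ((F.objObjPreimageIso (T j)).hom ≫ i j)) =
      (F.objObjPreimageIso (T j)).hom ≫ i j := fun j => F.map_preimage _
  refine ⟨J, fun j => F.objPreimage (T j), fun j => F.preimage ((F.objObjPreimageIso (T j)).hom ≫ i j),
    fun j => ?_, ⟨Cofan.IsColimit.mk _ (fun t => F.preimage (Cofan.IsColimit.desc hc fun j =>
      (F.objObjPreimageIso (T j)).inv ≫ F.map (t.inj j))) ?_ ?_⟩⟩
  · have := hT j
    have : Simple (F.obj (F.objPreimage (T j))) := Simple.of_iso (F.objObjPreimageIso (T j))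
    exact F.simple_of_simple_obj _
  · intro t j
    apply F.map_injective
    have := Cofan.IsColimit.fac hc
      (fun j => (F.objObjPreimageIso (T j)).inv ≫ F.map (t.inj j)) j
    change i j ≫ _ = _ at this
    rw [F.map_comp, F.map_preimage]
    change F.map (F.preimage _) ≫ _ = _
    rw [hi, Category.assoc]
    erw [this]
    rw [Iso.hom_inv_id_assoc]
  · intro t m hm
    apply F.map_injective
    rw [F.map_preimage]
    refine Cofan.IsColimit.hom_ext hc _ _ fun j => ?_
    rw [Cofan.IsColimit.fac, ← hm j, F.map_comp]
    change i j ≫ _ = _ ≫ F.map (F.preimage _) ≫ _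
    rw [hi]
    simp

lemma IsAb5Category.of_isEquivalence {C D : Type*} [Category.{u} C] [Category.{u} D]
    (F : C ⥤ D) [F.IsEquivalence] (h : IsAb5Category D) : IsAb5Category C := by
  obtain ⟨hcolim, hD⟩ := h
  have hC : HasColimits C := Adjunction.has_colimits_of_equivalence F
  exact ⟨hC, ⟨fun J _ _ => HasExactColimitsOfShape.of_codomain_equivalence J F.asEquivalence.symm⟩⟩

include he in
lemma IsSimpleDecomposition.contra :
    IsAb5Category (Contra S) ∧ IsSemisimpleCategory (Contra S) :=
  ⟨.of_isEquivalence (finitePartFunctor he) (isAb5Category_torsionClass _),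
    .of_isEquivalence (finitePartFunctor he) (torsionClass_isSemisimpleCategory_iff.2 fun N =>
      isSemisimpleModule_of_cornerFilter he N.property)⟩

end

end

end TopSemisimple

/-! ### Assembly of the equivalences -/

theorem mainTheorem1 (S : Type u) [Ring S] [UniformSpace S] [IsUniformAddGroup S]
    [IsTopologicalRing S] [IsLinearTopology Sᵐᵒᵖ S] [CompleteSpace S] [T2Space S] :
    List.TFAE [
      TopSemisimple.IsAb5Category (TopSemisimple.Contra S) ∧
        TopSemisimple.IsSemisimpleCategory (TopSemisimple.Contra S),
      TopSemisimple.IsSplitCategory (TopSemisimple.Discr S),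
      TopSemisimple.IsSemisimpleCategory (TopSemisimple.Discr S),
      ∃ (A M : Type u) (_ : Ring A) (_ : AddCommGroup M) (_ : Module A M),
        IsSemisimpleModule A M ∧ TopSemisimple.IsTopRingIso S (TopSemisimple.EndOp A M),
      ∃ (X : Type u) (Y : X → Type u) (D : X → Type u) (_ : ∀ x, DivisionRing (D x)),
        (∀ x, Nonempty (Y x)) ∧
          TopSemisimple.IsTopRingIso S (∀ x, TopSemisimple.EndOp (D x) (Y x →₀ D x)),
      ∃ (X : Type u) (Y : X → Type u) (D : X → Type u) (_ : ∀ x, DivisionRing (D x)),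
        (∀ x, Nonempty (Y x)) ∧
          TopSemisimple.IsTopRingIso S (∀ x, TopSemisimple.RowFiniteMatrix (Y x) (D x))] := by
  have of_decomposition : (∃ (ι : Type u) (e : ι → S), TopSemisimple.IsSimpleDecomposition e) →
      ∀ X : TopSemisimple.Discr S, IsSemisimpleModule Sᵐᵒᵖ X.obj :=
    fun ⟨_, _, he⟩ => he.isSemisimpleModule_discr
  tfae_have 2 ↔ 3 := by
    rw [TopSemisimple.isSplitCategory_discr_iff, TopSemisimple.isSemisimpleCategory_discr_iff]
  tfae_have 1 → 3 := fun h =>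
    (TopSemisimple.isSemisimpleCategory_discr_iff S).2
      (of_decomposition h.2.exists_isSimpleDecomposition)
  tfae_have 3 → 4 := fun h =>
    TopSemisimple.exists_isTopRingIso_endOp
      ((TopSemisimple.isSemisimpleCategory_discr_iff S).1 h)
  tfae_have 4 → 1 := by
    rintro ⟨A, M, _, _, _, _, h⟩
    obtain ⟨ι, e, he⟩ := TopSemisimple.EndOp.exists_isSimpleDecomposition A M
    obtain ⟨e', he'⟩ := he.of_isTopRingIso h
    exact he'.contra
  tfae_have 3 → 5 := fun h =>
    TopSemisimple.exists_isTopRingIso_pi_endOp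
      ((TopSemisimple.isSemisimpleCategory_discr_iff S).1 h)
  tfae_have 5 → 1 := by
    rintro ⟨X, Y, D, _, -, h⟩
    choose κ e he using fun x =>
      TopSemisimple.EndOp.exists_isSimpleDecomposition (D x) (Y x →₀ D x)
    obtain ⟨e', he'⟩ := TopSemisimple.IsSimpleDecomposition.pi he
    obtain ⟨e'', he''⟩ := he'.of_isTopRingIso h
    exact he''.contra
  tfae_have 5 → 6 := by
    rintro ⟨X, Y, D, _, hY, h⟩
    exact ⟨X, Y, D, _, hY,
      h.trans (.pi fun x => TopSemisimple.EndOp.isTopRingIso_rowFiniteMatrix (Y x) (D x))⟩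
  tfae_have 6 → 5 := by
    rintro ⟨X, Y, D, _, hY, h⟩
    exact ⟨X, Y, D, _, hY,
      h.trans (.pi fun x => (TopSemisimple.EndOp.isTopRingIso_rowFiniteMatrix (Y x) (D x)).symm)⟩
  tfae_finish
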